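/- **Theorem (performance bound of delayed optimal tracking, DOT).** Setting. Let $K$ be the number of arms and $B\ge 1$ a number of batches. The arms belong either to the Bernoulli family ($\mathcal Q=[0,1]$) or to the Gaussian family with known standard deviation $\sigma>0$ ($\mathcal Q=\mathbb R$); distributions are identified with their means. Let $\Theta\subset\mathcal Q$ be the set of possible means of an arm and let $H:\Theta^K\to(0,\infty]$ be any complexity measure. For $P\in\Theta^K$ let $\mathcal I^*(P)=\arg\max_i P_i$, let $D(q\|p)$ be the Kullback–Leibler divergence between the members of the family with means $q$ and $p$, and let $\Delta_K$ be the probability simplex. With $0\cdot\infty=0$, for functions $r_b:\mathcal Q^{Kb}\to\Delta_K$ ($1\le b\le B$) and $J:\mathcal Q^{KB}\to\{1,\dots,K\}$ put $$V(r,J)=\inf_{Q\in\mathcal Q^{KB}}\ \inf_{P\in\Theta^K:\,J(Q)\notin\mathcal I^*(P)}\ \frac{H(P)}{B}\sum_{b=1}^B\sum_{i=1}^K r_{b,i}(Q_1,\dots,Q_b)\,D(Q_{b,i}\|P_i),\qquad R^{\mathrm{go}}_B=\sup_{r,J}V(r,J)\in[0,\infty].$$ Let $\varepsilon\ge 0$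 and let $(r^*,J^*)$ be $\varepsilon$-optimal: $V(r^*,J^*)\ge R^{\mathrm{go}}_B-\varepsilon$. Algorithm. Let $T=(B+K-1)T_B$ with $T_B\ge K$, so that $T':=T-(B+K-1)K\ge 0$. DOT runs $B+K-1$ batches of $T_B$ rounds; the reward of each round is drawn independently from the distribution of the arm drawn. For $b\le K$, batch $b$ draws arm $b$ in all $T_B$ rounds; $Q'_1$ is the vector of the $K$ resulting empirical means. For $b=K+1,\dots,B+K-1$, put $r_b=r^*_{b-K}(Q'_1,\dots,Q'_{b-K})$, draw each arm $i$ exactly $n_{b,i}$ times in batch $b$, where $\sum_i n_{b,i}=T_B$ and $n_{b,i}\ge r_{b,i}(T_B-K)$ (the draws being any choice determined by $b$ and $Q'_1,\dots,Q'_{b-K}$), let $Q_b$ be the vector of empirical means of the batch (an arbitrary fixed value for arms not drawn), and put $Q'_{b-K+1,i}=Q'_{b-K,i}+r_{b,i}(Q_{b,i}-Q'_{b-K,i})$. DOT recommends $J(T)=J^*(Q'_1,\dots,Q'_B)$. Claim. Let $P\in\Theta^K$ be the true instance. In the Bernoulli case for every such $T$, and in the Gaussian case for every such $T$ that is large compared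 with the instance in the sense that $\big(R^{\mathrm{go}}_B-\varepsilon\big)/H(P)\le T^3$ (no condition is needed if $R^{\mathrm{go}}_B=\infty$), $$\mathbb P\big[J(T)\notin\mathcal I^*(P)\big]\ \le\ \exp\!\Big(-\frac{B\,T'}{B+K-1}\cdot\frac{R^{\mathrm{go}}_B-\varepsilon}{H(P)}+2BK\log(2T)\Big).$$ Here $0\cdot\infty=0$, $\infty/\infty=0$ and $e^{-\infty}=0$. -/

import Mathlib

open MeasureTheory ProbabilityTheory
open scoped ENNReal

noncomputable section

namespace DOT

/-- The one-parameter families of arm distributions: all Bernoulli distributions, or all Gaussian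
distributions with a fixed standard deviation `σ > 0`. Members are identified with their means. -/
inductive RewardModel : Type
  | bernoulli : RewardModel
  | gaussian (σ : ℝ) (hσ : 0 < σ) : RewardModel

namespace RewardModel

/-- The parameter space of the full family `𝒬`: `[0, 1]` (Bernoulli) or `ℝ` (Gaussian). -/
def means : RewardModel → Set ℝ
  | bernoulli => Set.Icc 0 1
  | gaussian _ _ => Set.univ

/-- The distribution with mean `θ`. In the Bernoulli case `θ` is only ever used in `[0, 1]`
(other values are projected onto `[0, 1]`). -/
def law : RewardModel → ℝ → Measure ℝ
  | bernoulli, θ => bernoulliMeasure (1 : ℝ) 0 (Set.projIcc (0 : ℝ) 1 zero_le_one θ)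
  | gaussian σ _, θ => gaussianReal θ ⟨σ ^ 2, sq_nonneg σ⟩

/-- The Kullback–Leibler divergence `D(q ‖ p)` between the members with means `q` and `p`. -/
def kl (m : RewardModel) (q p : ℝ) : ℝ≥0∞ :=
  InformationTheory.klDiv (m.law q) (m.law p)

end RewardModel

/-- The set `𝓘*(P)` of best arms of the instance with means `P`. -/
def bestArms {K : ℕ} (P : Fin K → ℝ) : Set (Fin K) :=
  {i | ∀ j, P j ≤ P i}

/-- A candidate solution `(r^B, J)` of the batch problem. Batches are numbered from `0`;
`alloc b` maps the means `(Q_0, …, Q_b)` of the batches up to and including batch `b`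
to an allocation in the probability simplex (only `b < B` is ever used), and
`recommend` maps the means of all `B` batches to an arm. -/
structure BatchRule (K B : ℕ) where
  alloc : (b : ℕ) → (Fin (b + 1) → Fin K → ℝ) → Fin K → ℝ
  alloc_mem : ∀ b Q, alloc b Q ∈ stdSimplex ℝ (Fin K)
  recommend : (Fin B → Fin K → ℝ) → Fin K

/-- The objective of a batch rule: the infimum, over batch means `Q ∈ 𝒬^{KB}` and instances
`P ∈ 𝒫^K` for which `J(Q)` is not a best arm, of
`(H(P) / B) * ∑_{b, i} r_{b,i}(Q_0, …, Q_b) D(Q_{b,i} ‖ P_i)`. -/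
def objective {K B : ℕ} (m : RewardModel) (Θ : Set ℝ) (H : (Fin K → ℝ) → ℝ≥0∞)
    (π : BatchRule K B) : ℝ≥0∞ :=
  ⨅ (Q : Fin B → Fin K → ℝ) (_ : ∀ b i, Q b i ∈ m.means)
    (P : Fin K → ℝ) (_ : ∀ i, P i ∈ Θ) (_ : π.recommend Q ∉ bestArms P),
    H P / (B : ℝ≥0∞) *
      ∑ b : Fin B, ∑ i : Fin K,
        ENNReal.ofReal (π.alloc b (fun c => Q (Fin.castLE b.isLt c)) i) * m.kl (Q b i) (P i)

/-- The rate `R^go_B`: the supremum of the objective over all batch rules. -/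
def Rgo {K : ℕ} (B : ℕ) (m : RewardModel) (Θ : Set ℝ) (H : (Fin K → ℝ) → ℝ≥0∞) : ℝ≥0∞ :=
  ⨆ π : BatchRule K B, objective m Θ H π

/-- `π` is an `ε`-optimal solution of the problem that defines `R^go_B`. -/
def IsEpsOptimal {K B : ℕ} (m : RewardModel) (Θ : Set ℝ) (H : (Fin K → ℝ) → ℝ≥0∞) (ε : ℝ)
    (π : BatchRule K B) : Prop :=
  (Rgo B m Θ H : EReal) - (ε : EReal) ≤ (objective m Θ H π : EReal)

/-- The number of draws of arm `i` in a batch of `TB` rounds in which round `s` draws arm `A s`. -/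
def numDraws {K TB : ℕ} (A : Fin TB → Fin K) (i : Fin K) : ℕ :=
  (Finset.univ.filter (fun s => A s = i)).card

/-- The empirical mean of arm `i` over batch `β` (rounds `β * TB, …, β * TB + TB - 1`), when
round `s` of the batch draws arm `A s` and `x t j` is the reward of arm `j` at round `t`.
Only rewards of drawn arms enter. It is `0` if arm `i` is not drawn in the batch. -/
def batchMean {K TB : ℕ} (x : ℕ → Fin K → ℝ) (β : ℕ) (A : Fin TB → Fin K) (i : Fin K) : ℝ :=
  (∑ s ∈ Finset.univ.filter (fun s => A s = i), x (β * TB + (s : ℕ)) i) / (numDraws A i : ℝ)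

/-- The choice of the actual draws in the adaptive batches: after `K + a` batches, with stored
means `(Q'_0, …, Q'_a)`, the `TB` arms drawn in the next batch, in order. -/
abbrev Schedule (K TB : ℕ) : Type :=
  (a : ℕ) → (Fin (a + 1) → Fin K → ℝ) → Fin TB → Fin K

/-- The draws follow the allocation of `π`: in each of the `B - 1` adaptive batches, arm `i` is
drawn `n_i ≥ r_i (TB - K)` times (and `∑ i, n_i = TB` holds by construction). -/
def Schedule.Follows {K B TB : ℕ} (A : Schedule K TB) (π : BatchRule K B) : Prop :=
  ∀ a : ℕ, a + 1 < B → ∀ (Q : Fin (a + 1) → Fin K → ℝ) (i : Fin K),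
    π.alloc a Q i * ((TB : ℝ) - (K : ℝ)) ≤ (numDraws (A a Q) i : ℝ)

/-- The stored means `(Q'_0, …, Q'_a)` of DOT run with the rule `π` and the draws `A` on the
rewards `x`. Batches `0, …, K - 1` draw arms `0, …, K - 1` for `TB` rounds each, which gives `Q'_0`.
Batch `K + a` uses `r = π.alloc a (Q'_0, …, Q'_a)`; if its empirical means are `Q`,
then `Q'_{a+1} = Q'_a + r (Q - Q'_a)`, componentwise. -/
def stored {K B TB : ℕ} (π : BatchRule K B) (A : Schedule K TB) (x : ℕ → Fin K → ℝ) :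
    (a : ℕ) → Fin (a + 1) → Fin K → ℝ
  | 0 => fun _ i => batchMean x (i : ℕ) (fun _ : Fin TB => i) i
  | a + 1 =>
    Fin.snoc (α := fun _ => Fin K → ℝ) (stored π A x a) (fun i =>
      stored π A x a (Fin.last a) i +
        π.alloc a (stored π A x a) i *
          (batchMean x (K + a) (A a (stored π A x a)) i - stored π A x a (Fin.last a) i))

/-- The arm recommended by DOT after `B + K - 1` batches: `J(Q'_0, …, Q'_{B-1})`. -/
def recommendation {K B TB : ℕ} (π : BatchRule K B) (A : Schedule K TB)
    (x : ℕ → Fin K → ℝ) : Fin K :=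
  π.recommend (fun b : Fin B => stored π A x (b : ℕ) (Fin.last (b : ℕ)))

end DOT

end

/-!
Write `Q'_a` for the stored means, `Q_β` for the empirical means of batch `β`, and `n_{β,i}` for the
number of draws of arm `i` in that batch. The proof compares two quantities: the weighted divergence
`∑ r_{b,i} D(Q'_{b,i} ‖ P_i)` that appears in the objective of the rule, and the statistic
`∑ n_{β,i} D(Q_{β,i} ‖ P_i)` of the rewards actually drawn.

*Deterministic part.* The divergence is convex in its first argument, so the update
`Q'_{a+1} = Q'_a + r (Q - Q'_a)` gives `r D(Q) ≥ D(Q'_{a+1}) - (1 - r) D(Q'_a)`. Summed over the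
batches this telescopes, and since `n ≥ r (TB - K)`, the statistic is at least `TB - K` times the
weighted divergence (`weighted_div_current_le`). If the recommended arm is not a best arm, then
`ε`-optimality bounds the weighted divergence from below by `B (R^go_B - ε) / H(P)`, so a wrong
recommendation forces the statistic to be at least
`C = B (TB - K) (R^go_B - ε) / H(P)` (`ofReal_le_statistic`).

*Probabilistic part.* For one arm in one batch with a fixed number `n` of draws,
`exp (lam n D(empirical mean ‖ p))` has a moderate expectation. In the Bernoulli case, with
`lam = 1`, it is dominated by the sum of the likelihood ratios over the `n + 1` possible empirical
means, hence has expectation at most `n + 1`. In the Gaussian case `n D` is half the square of a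
standard Gaussian, and the expectation is `(1 - lam) ^ (-1/2)` for `lam < 1`. The draws of a batch
depend only on earlier rewards, so these bounds multiply over the at most `B K` pairs of a batch and
an arm drawn in it (`lintegral_prod_batchProd_le`), and Markov's inequality bounds the error
probability by `exp (-lam C) c ^ (B K)` (`measure_recommendation_notMem_le`).

For Bernoulli arms `c = TB + 1 ≤ (2 T) ^ 2` gives the claim. For Gaussian arms, the choice
`lam = 1 - B K / (2 C)` gives it, the assumption on `T` ensuring `2 C / (B K) ≤ 2 T ^ 4`.

No measurability of the rule is assumed for Bernoulli arms: the rewards are replaced by almost surely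
equal measurable ones with values in `{0, 1}`, and everything that depends on finitely many of those
is measurable.
-/

noncomputable section

namespace DOT

/-! ### Explicit bounds for the divergence -/

/-- One summand `q log (q / p) + p - q = p klFun (q / p)` of the Bernoulli divergence, for
`q, p ≥ 0`, with value `0` if `p = q = 0` and `∞` if `p = 0 < q`. -/
def klTerm (q p : ℝ) : ℝ≥0∞ :=
  if p = 0 then (if q = 0 then 0 else ⊤) else
    ENNReal.ofReal (p * InformationTheory.klFun (q / p))

/-- Explicit formula for the divergence between members of the family with means `q` and `p`. -/
def RewardModel.div : RewardModel → ℝ → ℝ → ℝ≥0∞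
  | .bernoulli, q, p => klTerm q p + klTerm (1 - q) (1 - p)
  | .gaussian σ _, q, p => ENNReal.ofReal ((q - p) ^ 2 / (2 * σ ^ 2))

lemma klTerm_convex {x y p r : ℝ} (hx : 0 ≤ x) (hy : 0 ≤ y) (hp : 0 ≤ p) (hr : 0 ≤ r)
    (hr1 : r ≤ 1) :
    klTerm (x + r * (y - x)) p ≤
      ENNReal.ofReal (1 - r) * klTerm x p + ENNReal.ofReal r * klTerm y p := by
  unfold klTerm
  by_cases hp0 : p = 0
  · simp only [hp0, if_true]
    by_cases hz : x + r * (y - x) = 0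
    · simp [hz]
    · rw [if_neg hz, top_le_iff]
      by_cases h1 : (1 - r) * x = 0
      · have h2 : r * y ≠ 0 := by
          intro h; apply hz; linarith
        have hr0 : ENNReal.ofReal r ≠ 0 := by
          simpa using lt_of_le_of_ne hr (Ne.symm (left_ne_zero_of_mul h2))
        rw [if_neg (right_ne_zero_of_mul h2), ENNReal.mul_top hr0]
        simp
      · have hr0 : ENNReal.ofReal (1 - r) ≠ 0 := by
          have := lt_of_le_of_ne (sub_nonneg.2 hr1) (Ne.symm (left_ne_zero_of_mul h1))
          simpa using this
        rw [if_neg (right_ne_zero_of_mul h1), ENNReal.mul_top hr0]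
        simp
  · simp only [hp0, if_false]
    have h0 : ∀ z : ℝ, 0 ≤ z → 0 ≤ p * InformationTheory.klFun (z / p) := fun z hz =>
      mul_nonneg hp (InformationTheory.klFun_nonneg (div_nonneg hz hp))
    rw [← ENNReal.ofReal_mul (sub_nonneg.2 hr1), ← ENNReal.ofReal_mul hr,
      ← ENNReal.ofReal_add (mul_nonneg (sub_nonneg.2 hr1) (h0 x hx)) (mul_nonneg hr (h0 y hy))]
    apply ENNReal.ofReal_le_ofReal
    have h := InformationTheory.convexOn_klFun.2 (Set.mem_Ici.2 (div_nonneg hx hp))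
      (Set.mem_Ici.2 (div_nonneg hy hp)) (sub_nonneg.2 hr1) hr (by ring)
    simp only [smul_eq_mul] at h
    have e : (x + r * (y - x)) / p = (1 - r) * (x / p) + r * (y / p) := by ring
    rw [e]
    calc _ ≤ p * _ := mul_le_mul_of_nonneg_left h hp
      _ = _ := by ring

/-- The divergence is convex in its first argument. -/
lemma RewardModel.div_convex (m : RewardModel) {x y p r : ℝ} (hx : x ∈ m.means)
    (hy : y ∈ m.means) (hp : p ∈ m.means) (hr : 0 ≤ r) (hr1 : r ≤ 1) :
    m.div (x + r * (y - x)) p ≤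
      ENNReal.ofReal (1 - r) * m.div x p + ENNReal.ofReal r * m.div y p := by
  cases m with
  | bernoulli =>
    simp only [RewardModel.means, Set.mem_Icc] at hx hy hp
    have h1 := klTerm_convex hx.1 hy.1 hp.1 hr hr1
    have h2 := klTerm_convex (sub_nonneg.2 hx.2) (sub_nonneg.2 hy.2) (sub_nonneg.2 hp.2) hr hr1
    have e : 1 - (x + r * (y - x)) = 1 - x + r * (1 - y - (1 - x)) := by ring
    simp only [RewardModel.div]
    rw [e]
    refine (add_le_add h1 h2).trans (le_of_eq ?_)
    ring
  | gaussian σ hσ =>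
    simp only [RewardModel.div]
    rw [← ENNReal.ofReal_mul (sub_nonneg.2 hr1), ← ENNReal.ofReal_mul hr, ← ENNReal.ofReal_add]
    · apply ENNReal.ofReal_le_ofReal
      rw [mul_div_assoc', mul_div_assoc', ← add_div]
      gcongr
      nlinarith [mul_nonneg (mul_nonneg hr (sub_nonneg.2 hr1)) (sq_nonneg (y - x))]
    · exact mul_nonneg (sub_nonneg.2 hr1) (by positivity)
    · positivity

lemma law_bernoulli_eq {q : ℝ} (hq : q ∈ Set.Icc (0 : ℝ) 1) :
    RewardModel.bernoulli.law q =
      ENNReal.ofReal q • Measure.dirac 1 + ENNReal.ofReal (1 - q) • Measure.dirac 0 := by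
  simp only [RewardModel.law, bernoulliMeasure_def, Set.projIcc_of_mem _ hq]
  congr 1
  · rw [ENNReal.ofReal_eq_coe_nnreal hq.1]; rfl
  · rw [ENNReal.ofReal_eq_coe_nnreal (sub_nonneg.2 hq.2)]; rfl

lemma lintegral_law_bernoulli {q : ℝ} (hq : q ∈ Set.Icc (0 : ℝ) 1) (f : ℝ → ℝ≥0∞) :
    ∫⁻ x, f x ∂(RewardModel.bernoulli.law q) =
      ENNReal.ofReal q * f 1 + ENNReal.ofReal (1 - q) * f 0 := by
  rw [law_bernoulli_eq hq, lintegral_add_measure, lintegral_smul_measure, lintegral_smul_measure,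
    lintegral_dirac, lintegral_dirac]
  rfl

instance instIsProbabilityMeasureLaw (m : RewardModel) (p : ℝ) : IsProbabilityMeasure (m.law p) := by
  cases m
  · exact inferInstanceAs (IsProbabilityMeasure (bernoulliMeasure _ _ _))
  · exact instIsProbabilityMeasureGaussianReal _ _

/-- The likelihood ratio of the Bernoulli distribution with mean `q` with respect to the one with
mean `p`, at the outcome `x`; outcomes other than `1` are read as `0`. For `p ∈ {0, 1}` the
conventions `0 / 0 = 0` and `a / 0 = ∞` for `a ≠ 0` of `ℝ≥0∞` apply. -/
def bernoulliRatio (q p x : ℝ) : ℝ≥0∞ :=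
  if x = 1 then ENNReal.ofReal q / ENNReal.ofReal p
  else ENNReal.ofReal (1 - q) / ENNReal.ofReal (1 - p)

lemma measurable_bernoulliRatio (q p : ℝ) : Measurable (bernoulliRatio q p) :=
  Measurable.ite (measurableSet_singleton 1) measurable_const measurable_const

lemma kl_le_div_bernoulli {q p : ℝ} (hq : q ∈ Set.Icc (0 : ℝ) 1) (hp : p ∈ Set.Icc (0 : ℝ) 1) :
    RewardModel.bernoulli.kl q p ≤ RewardModel.bernoulli.div q p := by
  by_cases hqp : q = p
  · subst hqp
    simp [RewardModel.kl, InformationTheory.klDiv_self]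
  by_cases hp0 : p = 0
  · subst hp0
    simp [RewardModel.div, klTerm, hqp]
  by_cases hp1 : p = 1
  · subst hp1
    have : 1 - q ≠ 0 := fun h => hqp (by linarith)
    simp [RewardModel.div, klTerm, this]
  have hp0' : 0 < p := lt_of_le_of_ne hp.1 (Ne.symm hp0)
  have hp1' : 0 < 1 - p := sub_pos.2 (lt_of_le_of_ne hp.2 hp1)
  have hpe : ENNReal.ofReal p ≠ 0 := by simpa using hp0'
  have hpe1 : ENNReal.ofReal (1 - p) ≠ 0 := by simpa using hp1'
  have hdens : RewardModel.bernoulli.law q =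
      (RewardModel.bernoulli.law p).withDensity (bernoulliRatio q p) := by
    ext s hs
    rw [withDensity_apply _ hs, ← lintegral_indicator hs, lintegral_law_bernoulli hp,
      ← lintegral_indicator_one hs, lintegral_law_bernoulli hq]
    congr 1
    · by_cases h : (1 : ℝ) ∈ s
      · simp [h, bernoulliRatio, ENNReal.mul_div_cancel hpe ENNReal.ofReal_ne_top]
      · simp [h]
    · by_cases h : (0 : ℝ) ∈ s
      · simp [h, bernoulliRatio, ENNReal.mul_div_cancel hpe1 ENNReal.ofReal_ne_top]
      · simp [h]
  have hac : RewardModel.bernoulli.law q ≪ RewardModel.bernoulli.law p := by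
    rw [hdens]; exact withDensity_absolutelyContinuous _ _
  have hrn : (RewardModel.bernoulli.law q).rnDeriv (RewardModel.bernoulli.law p)
      =ᵐ[RewardModel.bernoulli.law p] bernoulliRatio q p := by
    rw [hdens]; exact Measure.rnDeriv_withDensity _ (measurable_bernoulliRatio q p)
  rw [RewardModel.kl, InformationTheory.klDiv_eq_lintegral_klFun_of_ac hac]
  rw [lintegral_congr_ae (hrn.mono fun x hx => by rw [hx]), lintegral_law_bernoulli hp]
  simp only [RewardModel.div, klTerm, hp0, hp1'.ne', if_false, bernoulliRatio, if_true,
    zero_ne_one, ENNReal.toReal_div, ENNReal.toReal_ofReal hq.1, ENNReal.toReal_ofReal hp.1,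
    ENNReal.toReal_ofReal (sub_nonneg.2 hq.2), ENNReal.toReal_ofReal hp1'.le,
    ENNReal.ofReal_mul hp.1, ENNReal.ofReal_mul hp1'.le]
  exact le_rfl

lemma kl_le_div_gaussian {σ : ℝ} (hσ : 0 < σ) (q p : ℝ) :
    (RewardModel.gaussian σ hσ).kl q p ≤ (RewardModel.gaussian σ hσ).div q p := by
  simp only [RewardModel.kl, RewardModel.div, RewardModel.law]
  set v : NNReal := ⟨σ ^ 2, sq_nonneg σ⟩ with hv
  have hvr : (v : ℝ) = σ ^ 2 := rfl
  have hv0 : v ≠ 0 := by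
    intro h
    have : (v : ℝ) = 0 := by rw [h]; rfl
    rw [hvr] at this
    exact (pow_pos hσ 2).ne' this
  set f : ℝ → ℝ := fun x => ((x - p) ^ 2 - (x - q) ^ 2) / (2 * σ ^ 2) with hf
  have hfm : Measurable fun x => ENNReal.ofReal (Real.exp (f x)) := by fun_prop
  have hdens : gaussianReal q v =
      (gaussianReal p v).withDensity (fun x => ENNReal.ofReal (Real.exp (f x))) := by
    rw [gaussianReal_of_var_ne_zero _ hv0, gaussianReal_of_var_ne_zero _ hv0,
      ← withDensity_mul _ (measurable_gaussianPDF p v) hfm]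
    congr 1
    ext x
    simp only [Pi.mul_apply, gaussianPDF, gaussianPDFReal]
    rw [← ENNReal.ofReal_mul (by positivity), mul_assoc _ (Real.exp _), ← Real.exp_add]
    congr 3
    rw [hf, hvr]
    field_simp
    ring
  have hac : gaussianReal q v ≪ gaussianReal p v := by
    rw [hdens]; exact withDensity_absolutelyContinuous _ _
  have hllr : llr (gaussianReal q v) (gaussianReal p v) =ᵐ[gaussianReal q v]
      fun x => (q - p) / σ ^ 2 * x + (p ^ 2 - q ^ 2) / (2 * σ ^ 2) := by
    have hrn : (gaussianReal q v).rnDeriv (gaussianReal p v) =ᵐ[gaussianReal p v]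
        fun x => ENNReal.ofReal (Real.exp (f x)) := by
      conv_lhs => rw [hdens]
      exact Measure.rnDeriv_withDensity _ hfm
    filter_upwards [hac.ae_le hrn] with x hx
    rw [llr, hx, ENNReal.toReal_ofReal (Real.exp_pos _).le, Real.log_exp, hf]
    field_simp
    ring
  have hid : Integrable (fun x : ℝ => x) (gaussianReal q v) :=
    (memLp_id_gaussianReal 1).integrable (by simp)
  have hint : Integrable (fun x => (q - p) / σ ^ 2 * x + (p ^ 2 - q ^ 2) / (2 * σ ^ 2))
      (gaussianReal q v) := (hid.const_mul _).add (integrable_const _)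
  rw [InformationTheory.klDiv_of_ac_of_integrable hac ((integrable_congr hllr).2 hint)]
  apply ENNReal.ofReal_le_ofReal
  rw [integral_congr_ae hllr, integral_add (hid.const_mul _) (integrable_const _),
    integral_const_mul, integral_id_gaussianReal]
  simp only [integral_const, probReal_univ, smul_eq_mul, one_mul, add_sub_cancel_right]
  apply le_of_eq
  field_simp
  ring

lemma RewardModel.kl_le_div (m : RewardModel) {q p : ℝ} (hq : q ∈ m.means) (hp : p ∈ m.means) :
    m.kl q p ≤ m.div q p := by
  cases m with
  | bernoulli => exact kl_le_div_bernoulli hq hp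
  | gaussian σ hσ => exact kl_le_div_gaussian hσ q p

/-! ### Convexity along the run of the algorithm -/

section Deterministic

variable {K B TB : ℕ} (π : BatchRule K B) (A : Schedule K TB) (x : ℕ → Fin K → ℝ)

/-- The arms drawn in batch `β` of the whole run, the `K` initial batches included. -/
def draws (β : ℕ) : Fin TB → Fin K :=
  if h : β < K then fun _ => ⟨β, h⟩ else A (β - K) (stored π A x (β - K))

/-- The most recent stored means `Q'_a`. -/
def current (a : ℕ) : Fin K → ℝ := stored π A x a (Fin.last a)

lemma stored_eq_current (a : ℕ) (c : Fin (a + 1)) : stored π A x a c = current π A x c := by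
  induction a with
  | zero =>
    obtain rfl : c = Fin.last 0 := Subsingleton.elim (α := Fin 1) _ _
    rfl
  | succ a ih =>
    induction c using Fin.lastCases with
    | last => rfl
    | cast c =>
      rw [Fin.val_castSucc, ← ih c]
      simp only [stored, Fin.snoc_castSucc]

lemma draws_add (a : ℕ) : draws π A x (K + a) = A a (stored π A x a) := by
  have key : ∀ b, b = a → A b (stored π A x b) = A a (stored π A x a) := by
    rintro _ rfl
    rfl
  rw [draws, dif_neg (by omega)]
  exact key _ (by omega)

lemma current_succ (a : ℕ) (i : Fin K) :
    current π A x (a + 1) i = current π A x a i + π.alloc a (stored π A x a) i *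
      (batchMean x (K + a) (draws π A x (K + a)) i - current π A x a i) := by
  rw [draws_add]
  simp [current, stored]

lemma alloc_nonneg (b : ℕ) (Q : Fin (b + 1) → Fin K → ℝ) (i : Fin K) : 0 ≤ π.alloc b Q i :=
  (π.alloc_mem b Q).1 i

lemma alloc_le_one (b : ℕ) (Q : Fin (b + 1) → Fin K → ℝ) (i : Fin K) : π.alloc b Q i ≤ 1 := by
  rw [← (π.alloc_mem b Q).2]
  exact Finset.single_le_sum (fun j _ => alloc_nonneg π b Q j) (Finset.mem_univ i)

lemma RewardModel.convex_means (m : RewardModel) : Convex ℝ m.means := by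
  cases m
  · exact convex_Icc 0 1
  · exact convex_univ

/-- Stored means lie in the parameter space, being convex combinations of batch means. -/
lemma current_mem (m : RewardModel) (n : ℕ)
    (hmem : ∀ β < K + n, ∀ (S : Fin TB → Fin K) (i : Fin K), batchMean x β S i ∈ m.means) :
    ∀ a ≤ n, ∀ i, current π A x a i ∈ m.means := by
  intro a
  induction a with
  | zero => exact fun _ i => hmem i (by omega) _ i
  | succ a ih =>
    intro ha i
    rw [current_succ]
    have h := m.convex_means (ih (by omega) i) (hmem (K + a) (by omega) (draws π A x (K + a)) i)
      (sub_nonneg.2 (alloc_le_one π a (stored π A x a) i)) (alloc_nonneg π a (stored π A x a) i)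
      (by ring)
    convert h using 1
    simp only [smul_eq_mul]
    ring

/-- Convexity of the divergence along `Q'_{a+1} = Q'_a + r (Q - Q'_a)`, telescoped: the divergences
of the stored means are dominated by those of the empirical means. -/
lemma div_current_add_sum_le (m : RewardModel) {p : ℝ} (hp : p ∈ m.means) (i : Fin K) (n : ℕ)
    (hmem : ∀ β < K + n, ∀ (S : Fin TB → Fin K) (i : Fin K), batchMean x β S i ∈ m.means) :
    ∀ k ≤ n, m.div (current π A x k i) p + ∑ a ∈ Finset.range k,
        ENNReal.ofReal (π.alloc a (stored π A x a) i) * m.div (current π A x a i) p ≤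
      m.div (current π A x 0 i) p + ∑ a ∈ Finset.range k,
        ENNReal.ofReal (π.alloc a (stored π A x a) i) *
          m.div (batchMean x (K + a) (draws π A x (K + a)) i) p := by
  intro k
  induction k with
  | zero => simp
  | succ k ih =>
    intro hk
    rw [Finset.sum_range_succ, Finset.sum_range_succ]
    set r := π.alloc k (stored π A x k) i with hr
    have hr0 : 0 ≤ r := alloc_nonneg π _ _ _
    have hr1 : r ≤ 1 := alloc_le_one π _ _ _
    have hconv := m.div_convex (current_mem π A x m n hmem k (by omega) i)
      (hmem (K + k) (by omega) (draws π A x (K + k)) i) hp hr0 hr1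
    rw [← current_succ] at hconv
    set D := m.div (current π A x k i) p with hD
    have hsplit : ENNReal.ofReal (1 - r) * D + ENNReal.ofReal r * D = D := by
      rw [← add_mul, ← ENNReal.ofReal_add (sub_nonneg.2 hr1) hr0]
      simp
    calc _ ≤ (ENNReal.ofReal (1 - r) * D + ENNReal.ofReal r *
            m.div (batchMean x (K + k) (draws π A x (K + k)) i) p) + (∑ a ∈ Finset.range k,
            ENNReal.ofReal (π.alloc a (stored π A x a) i) * m.div (current π A x a i) p +
            ENNReal.ofReal r * D) := by gcongr
      _ = (D + ∑ a ∈ Finset.range k, ENNReal.ofReal (π.alloc a (stored π A x a) i) *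
            m.div (current π A x a i) p) +
            ENNReal.ofReal r * m.div (batchMean x (K + k) (draws π A x (K + k)) i) p := by
          conv_rhs => rw [← hsplit]
          ring
      _ ≤ _ := by
          rw [← add_assoc]
          exact add_le_add_left (ih (by omega)) _

/-- The weighted divergence that the objective sees at the stored means is at most the
statistic `∑ n_{β,i} D(Q_{β,i} ‖ P_i)` of the actual draws, up to the factor `TB - K`. The initial
batches contribute `TB * D(Q'_0)`, and `r ≤ 1` is used in the last batch of the rule, which is
never run. -/
lemma weighted_div_current_le (hB : 0 < B) (m : RewardModel) {P : Fin K → ℝ}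
    (hP : ∀ i, P i ∈ m.means) (hA : A.Follows π)
    (hmem : ∀ β < K + (B - 1), ∀ (S : Fin TB → Fin K) (i : Fin K), batchMean x β S i ∈ m.means) :
    ENNReal.ofReal ((TB : ℝ) - K) * ∑ b ∈ Finset.range B, ∑ i : Fin K,
        ENNReal.ofReal (π.alloc b (stored π A x b) i) * m.div (current π A x b i) (P i) ≤
      ∑ β ∈ Finset.range (K + (B - 1)), ∑ i : Fin K,
        (numDraws (draws π A x β) i : ℝ≥0∞) *
          m.div (batchMean x β (draws π A x β) i) (P i) := by
  obtain ⟨n, rfl⟩ : ∃ n, B = n + 1 := ⟨B - 1, by omega⟩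
  simp only [Nat.add_sub_cancel] at hmem ⊢
  have hinit : ∀ i : Fin K, ∑ β ∈ Finset.range K,
      (numDraws (draws π A x β) i : ℝ≥0∞) * m.div (batchMean x β (draws π A x β) i) (P i) =
      TB * m.div (current π A x 0 i) (P i) := by
    intro i
    rw [Finset.sum_eq_single (i : ℕ)]
    · have : draws π A x (i : ℕ) = fun _ : Fin TB => i := by
        simp [draws]
      rw [this]
      simp [numDraws, current, stored]
    · intro β hβ hne
      have hβ' : β < K := Finset.mem_range.1 hβ
      have : numDraws (draws π A x β) i = 0 := by
        simp only [numDraws, Finset.card_eq_zero, Finset.filter_eq_empty_iff]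
        intro s _ h
        rw [draws, dif_pos hβ'] at h
        exact hne (congrArg Fin.val h)
      simp [this]
    · intro h
      exact absurd (Finset.mem_range.2 i.isLt) h
  rw [Finset.sum_comm, Finset.sum_comm (s := Finset.range (K + n)), Finset.mul_sum]
  refine Finset.sum_le_sum fun i _ => ?_
  rw [Finset.sum_range_add _ K n, hinit i]
  have htel := div_current_add_sum_le π A x m (hP i) i n hmem n le_rfl
  have hlast : ∑ b ∈ Finset.range (n + 1),
      ENNReal.ofReal (π.alloc b (stored π A x b) i) * m.div (current π A x b i) (P i) ≤
      m.div (current π A x n i) (P i) + ∑ a ∈ Finset.range n,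
        ENNReal.ofReal (π.alloc a (stored π A x a) i) * m.div (current π A x a i) (P i) := by
    rw [Finset.sum_range_succ, add_comm]
    gcongr
    refine mul_le_of_le_one_left zero_le ?_
    simpa using alloc_le_one π n (stored π A x n) i
  refine (mul_le_mul_right (hlast.trans htel) _).trans ?_
  rw [mul_add, Finset.mul_sum]
  refine add_le_add (mul_le_mul_left ?_ _) (Finset.sum_le_sum fun a ha => ?_)
  · refine (ENNReal.ofReal_le_ofReal (sub_le_self _ (Nat.cast_nonneg K))).trans ?_
    simp
  · rw [← mul_assoc]
    refine mul_le_mul_left ?_ _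
    rw [mul_comm, ← ENNReal.ofReal_mul (alloc_nonneg π _ _ _)]
    have h := hA a (by have := Finset.mem_range.1 ha; omega) (stored π A x a) i
    rw [draws_add]
    exact (ENNReal.ofReal_le_ofReal h).trans (by simp)

/-- The objective of the rule bounds the statistic of the draws from below whenever the
recommendation is wrong. -/
lemma objective_le_of_recommendation_notMem (hB : 0 < B) (m : RewardModel) {Θ : Set ℝ}
    (hΘ : Θ ⊆ m.means) (H : (Fin K → ℝ) → ℝ≥0∞) {P : Fin K → ℝ} (hP : ∀ i, P i ∈ Θ)
    (hmem : ∀ β < K + (B - 1), ∀ (S : Fin TB → Fin K) (i : Fin K), batchMean x β S i ∈ m.means)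
    (hrec : recommendation π A x ∉ bestArms P) :
    objective m Θ H π ≤ H P / B * ∑ b ∈ Finset.range B, ∑ i : Fin K,
        ENNReal.ofReal (π.alloc b (stored π A x b) i) * m.div (current π A x b i) (P i) := by
  have hcur : ∀ b : Fin B, ∀ i, current π A x b i ∈ m.means := fun b i =>
    current_mem π A x m (B - 1) hmem b (by omega) i
  refine (iInf₂_le_of_le (fun b : Fin B => current π A x b) hcur <|
    iInf₂_le_of_le P hP <| iInf_le_of_le hrec le_rfl).trans ?_
  rw [Finset.sum_range]
  gcongr with b _ i _
  · apply le_of_eq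
    congr 1
    funext c
    exact (stored_eq_current π A x b c).symm
  · exact m.kl_le_div (hcur b i) (hΘ (hP i))

end Deterministic

/-! ### Products of statistics of adaptively drawn batches -/

section Independence

variable {Ω : Type*} {mΩ : MeasurableSpace Ω} {μ : Measure Ω}

/-- The expectation of a product of functions of disjoint groups of independent σ-algebras. -/
lemma lintegral_prod_eq_of_pairwiseDisjoint [IsProbabilityMeasure μ] {ι κ : Type*}
    {M : κ → MeasurableSpace Ω} (hle : ∀ k, M k ≤ mΩ) (hind : iIndep M μ) (U : ι → Set κ)
    (hU : Pairwise fun i j => Disjoint (U i) (U j)) (f : ι → Ω → ℝ≥0∞)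
    (hf : ∀ i, Measurable[⨆ k ∈ U i, M k] (f i)) (s : Finset ι) :
    ∫⁻ ω, ∏ i ∈ s, f i ω ∂μ = ∏ i ∈ s, ∫⁻ ω, f i ω ∂μ := by
  induction s using Finset.cons_induction with
  | empty => simp
  | cons j s hj ih =>
    simp only [Finset.prod_cons]
    rw [← ih]
    have hdisj : Disjoint (U j) (⋃ i ∈ s, U i) := by
      simp only [Set.disjoint_iUnion_right]
      intro i hi
      exact hU (fun h => hj (h ▸ hi))
    refine lintegral_mul_eq_lintegral_mul_lintegral_of_independent_measurableSpace
      (iSup₂_le fun k _ => hle k) (iSup₂_le fun k _ => hle k)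
      (indep_iSup_of_disjoint hle hind hdisj) (hf j) ?_
    refine Finset.measurable_prod _ fun i hi => (hf i).mono ?_ le_rfl
    exact biSup_mono fun k hk => Set.mem_biUnion hi hk

variable {K TB T : ℕ}

/-- The σ-algebra generated by the rewards of the rounds `t < n`. -/
@[reducible] def past (X : ℕ → Fin K → Ω → ℝ) (T n : ℕ) : MeasurableSpace Ω :=
  ⨆ p ∈ {p : Fin T × Fin K | (p.1 : ℕ) < n}, (inferInstance : MeasurableSpace ℝ).comap (X p.1 p.2)

lemma past_mono (X : ℕ → Fin K → Ω → ℝ) (T : ℕ) : Monotone (past X T) := fun _ _ h =>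
  biSup_mono fun _ hp => lt_of_lt_of_le hp h

lemma past_le {X : ℕ → Fin K → Ω → ℝ} (hX : ∀ t < T, ∀ i, Measurable (X t i)) (n : ℕ) :
    past X T n ≤ mΩ :=
  iSup₂_le fun p _ => (hX p.1 p.1.isLt p.2).comap_le

lemma measurable_past {X : ℕ → Fin K → Ω → ℝ} {t n : ℕ} (ht : t < n) (htT : t < T) (i : Fin K) :
    Measurable[past X T n] (X t i) := by
  have hp : ((⟨t, htT⟩, i) : Fin T × Fin K) ∈ {p : Fin T × Fin K | (p.1 : ℕ) < n} := ht
  exact measurable_iff_comap_le.2 (le_biSup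
    (fun p : Fin T × Fin K => (inferInstance : MeasurableSpace ℝ).comap (X p.1 p.2)) hp)

/-- Composition with a family of random variables, for a σ-algebra that is not the ambient one. -/
lemma measurable_comp_family (m : MeasurableSpace Ω) {ι γ : Type*} [MeasurableSpace γ]
    {Ψ : (ι → ℝ) → γ} (hΨ : Measurable Ψ) {Y : ι → Ω → ℝ} (hY : ∀ r, Measurable (Y r)) :
    Measurable fun ω => Ψ (fun r => Y r ω) :=
  hΨ.comp (measurable_pi_lambda _ hY)

/-- The product over the arms of the statistics `Φ i` of the rewards drawn in batch `β`, if the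
batch draws the arms `a`. -/
def batchProd (X : ℕ → Fin K → Ω → ℝ) (Φ : Fin K → Finset (Fin TB) → (Fin TB → ℝ) → ℝ≥0∞)
    (β : ℕ) (a : Fin TB → Fin K) (ω : Ω) : ℝ≥0∞ :=
  ∏ i, Φ i (Finset.univ.filter (fun s => a s = i)) (fun s => X (β * TB + s) i ω)

lemma batchProd_eq_sum (X : ℕ → Fin K → Ω → ℝ)
    (Φ : Fin K → Finset (Fin TB) → (Fin TB → ℝ) → ℝ≥0∞) (β : ℕ) (S : Ω → Fin TB → Fin K)
    (ω : Ω) : batchProd X Φ β (S ω) ω =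
      ∑ a, {ω | S ω = a}.indicator (fun _ => 1) ω * batchProd X Φ β a ω := by
  rw [Finset.sum_eq_single (S ω)]
  · simp
  · intro a _ ha
    have : ω ∉ {ω | S ω = a} := fun h => ha h.symm
    simp [this]
  · simp

lemma round_lt {β TB T : ℕ} (h : (β + 1) * TB ≤ T) (s : Fin TB) : β * TB + (s : ℕ) < T := by
  have := s.isLt
  rw [Nat.add_mul, Nat.one_mul] at h
  omega

lemma measurable_prod_batchProd {X : ℕ → Fin K → Ω → ℝ} {S : ℕ → Ω → Fin TB → Fin K}
    {Φ : Fin K → Finset (Fin TB) → (Fin TB → ℝ) → ℝ≥0∞} (hΦm : ∀ i s, Measurable (Φ i s))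
    {N : ℕ} (hN : N * TB ≤ T) (hS : ∀ β < N, Measurable[past X T (β * TB)] (S β)) :
    Measurable[past X T (N * TB)]
      fun ω => ∏ β ∈ Finset.range N, batchProd X Φ β (S β ω) ω := by
  refine Finset.measurable_prod _ fun β hβ => ?_
  have hβN : β + 1 ≤ N := Finset.mem_range.1 hβ
  have hle : (β + 1) * TB ≤ N * TB := Nat.mul_le_mul_right _ hβN
  have hSβ : Measurable[past X T (N * TB)] (S β) :=
    (hS β (by omega)).mono (past_mono X T (Nat.mul_le_mul_right _ (by omega))) le_rfl
  simp only [batchProd_eq_sum]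
  refine Finset.measurable_sum _ fun a _ => Measurable.mul ?_ ?_
  · exact Measurable.indicator measurable_const (hSβ (measurableSet_singleton a))
  · refine Finset.measurable_prod _ fun i _ =>
      measurable_comp_family _ (hΦm i _) (Y := fun r => X (β * TB + r) i) fun r => ?_
    exact measurable_past (round_lt hle r) (round_lt (hle.trans hN) r) i

/-- Sequential product bound: if, for each fixed set of draws, the statistic of an arm has
expectation at most `c` (and is `1` for an arm that is not drawn), and batch `β` draws at most `d β`
arms, chosen from the past, then the product of all statistics has expectation at most
`c ^ ∑ β, d β`. -/
lemma lintegral_prod_batchProd_le [IsProbabilityMeasure μ] {X : ℕ → Fin K → Ω → ℝ}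
    (hX : ∀ t < T, ∀ i, Measurable (X t i))
    (hind : iIndepFun (fun p : Fin T × Fin K => X p.1 p.2) μ)
    {S : ℕ → Ω → Fin TB → Fin K}
    {Φ : Fin K → Finset (Fin TB) → (Fin TB → ℝ) → ℝ≥0∞} (hΦm : ∀ i s, Measurable (Φ i s))
    {c : ℝ≥0∞} (hc : 1 ≤ c) (hΦ0 : ∀ i y, Φ i ∅ y = 1)
    (hΦ : ∀ β, (β + 1) * TB ≤ T → ∀ i s,
      ∫⁻ ω, Φ i s (fun r => X (β * TB + r) i ω) ∂μ ≤ c)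
    {d : ℕ → ℕ} (hd : ∀ β ω, (Finset.univ.filter fun i => ∃ s, S β ω s = i).card ≤ d β)
    (N : ℕ) (hN : N * TB ≤ T) (hS : ∀ β < N, Measurable[past X T (β * TB)] (S β)) :
    ∫⁻ ω, ∏ β ∈ Finset.range N, batchProd X Φ β (S β ω) ω ∂μ ≤
      c ^ ∑ β ∈ Finset.range N, d β := by
  induction N with
  | zero => simp
  | succ N ih =>
    have hNT : N * TB ≤ T := (Nat.mul_le_mul_right _ (Nat.le_succ N)).trans hN
    set M : Fin T × Fin K → MeasurableSpace Ω :=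
      fun p => (inferInstance : MeasurableSpace ℝ).comap (X p.1 p.2) with hM
    have hMle : ∀ p, M p ≤ mΩ := fun p => (hX p.1 p.1.isLt p.2).comap_le
    have hMind : iIndep M μ := hind
    set row : Fin K → Set (Fin T × Fin K) := fun i => {p | N * TB ≤ (p.1 : ℕ) ∧ p.2 = i} with hrow
    have hmeas : ∀ (i : Fin K) (s : Finset (Fin TB)),
        Measurable[⨆ p ∈ row i, M p] fun ω => Φ i s (fun r => X (N * TB + r) i ω) := by
      intro i s
      refine measurable_comp_family _ (hΦm i s) (Y := fun r => X (N * TB + r) i) fun r => ?_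
      refine (comap_measurable (X (N * TB + r) i)).mono ?_ le_rfl
      exact le_biSup M (i := (⟨N * TB + r, round_lt hN r⟩, i)) (s := row i)
        ⟨Nat.le_add_right _ _, rfl⟩
    set B : Set (Fin T × Fin K) := {p | N * TB ≤ (p.1 : ℕ)} with hB
    have hF : ∀ a, Measurable[⨆ p ∈ B, M p] (batchProd X Φ N a) := by
      intro a
      refine Finset.measurable_prod _ fun i _ => (hmeas i _).mono ?_ le_rfl
      exact biSup_mono fun p hp => hp.1
    have hFint : ∀ a, ∫⁻ ω, batchProd X Φ N a ω ∂μ ≤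
        c ^ (Finset.univ.filter fun i => ∃ s, a s = i).card := by
      intro a
      simp only [batchProd]
      rw [lintegral_prod_eq_of_pairwiseDisjoint hMle hMind row
        (fun i j hij => Set.disjoint_left.2 fun p hi hj => hij (hi.2.symm.trans hj.2))
        (fun i ω => Φ i (Finset.univ.filter (fun s => a s = i)) (fun s => X (N * TB + s) i ω))
        (fun i => hmeas i _)]
      calc _ ≤ ∏ i : Fin K, if ∃ s, a s = i then c else 1 := by
            refine Finset.prod_le_prod' fun i _ => ?_
            split_ifs with h
            · exact hΦ N hN i _
            · have : Finset.univ.filter (fun s => a s = i) = ∅ := by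
                rw [Finset.filter_eq_empty_iff]
                exact fun s _ hs => h ⟨s, hs⟩
              simp [this, hΦ0]
        _ = _ := by rw [Finset.prod_ite]; simp
    -- the product over the earlier batches, and the event that `a` is drawn, are functions
    -- of the past
    set G : Ω → ℝ≥0∞ := fun ω => ∏ β ∈ Finset.range N, batchProd X Φ β (S β ω) ω with hG
    have hGm : Measurable[past X T (N * TB)] G :=
      measurable_prod_batchProd hΦm hNT fun β hβ => hS β (by omega)
    have hindic : ∀ a, Measurable[past X T (N * TB)]
        fun ω => G ω * {ω | S N ω = a}.indicator (fun _ => (1 : ℝ≥0∞)) ω := fun a =>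
      hGm.mul (Measurable.indicator measurable_const
        (hS N (Nat.lt_succ_self N) (measurableSet_singleton a)))
    have hpl : past X T (N * TB) ≤ mΩ := past_le hX _
    have hBle : (⨆ p ∈ B, M p) ≤ mΩ := iSup₂_le fun p _ => hMle p
    have hdisj : Disjoint {p : Fin T × Fin K | (p.1 : ℕ) < N * TB} B :=
      Set.disjoint_left.2 fun p hp hq => (not_lt.2 hq : ¬(p.1 : ℕ) < N * TB) hp
    have hsum : ∀ ω, ∑ a, {ω | S N ω = a}.indicator (fun _ => (1 : ℝ≥0∞)) ω = 1 := by
      intro ω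
      rw [Finset.sum_eq_single (S N ω)]
      · simp
      · intro a _ ha
        have : ω ∉ {ω | S N ω = a} := fun h => ha h.symm
        simp [this]
      · simp
    calc ∫⁻ ω, ∏ β ∈ Finset.range (N + 1), batchProd X Φ β (S β ω) ω ∂μ
        = ∫⁻ ω, ∑ a, (G ω * {ω | S N ω = a}.indicator (fun _ => 1) ω) *
            batchProd X Φ N a ω ∂μ := by
          refine lintegral_congr fun ω => ?_
          rw [Finset.prod_range_succ, batchProd_eq_sum X Φ N, Finset.mul_sum]
          exact Finset.sum_congr rfl fun a _ => (mul_assoc _ _ _).symm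
      _ = ∑ a, (∫⁻ ω, G ω * {ω | S N ω = a}.indicator (fun _ => 1) ω ∂μ) *
            ∫⁻ ω, batchProd X Φ N a ω ∂μ := by
          rw [lintegral_finsetSum]
          · refine Finset.sum_congr rfl fun a _ => ?_
            exact lintegral_mul_eq_lintegral_mul_lintegral_of_independent_measurableSpace hpl hBle
              (indep_iSup_of_disjoint hMle hMind hdisj) (hindic a) (hF a)
          · exact fun a _ => ((hindic a).mono hpl le_rfl).mul ((hF a).mono hBle le_rfl)
      _ ≤ ∑ a, (∫⁻ ω, G ω * {ω | S N ω = a}.indicator (fun _ => 1) ω ∂μ) * c ^ d N := by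
          refine Finset.sum_le_sum fun a _ => ?_
          by_cases h : ∃ ω, S N ω = a
          · obtain ⟨ω, rfl⟩ := h
            gcongr
            exact (hFint _).trans (pow_le_pow_right₀ hc (hd N ω))
          · have : {ω | S N ω = a} = ∅ := Set.eq_empty_of_forall_notMem fun ω hω => h ⟨ω, hω⟩
            simp [this]
      _ = (∫⁻ ω, G ω ∂μ) * c ^ d N := by
          rw [← Finset.sum_mul, ← lintegral_finsetSum _ fun a _ => (hindic a).mono hpl le_rfl]
          congr 1
          refine lintegral_congr fun ω => ?_
          rw [← Finset.mul_sum, hsum, mul_one]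
      _ ≤ c ^ (∑ β ∈ Finset.range N, d β) * c ^ d N := by
          gcongr
          exact ih hNT fun β hβ => hS β (by omega)
      _ = _ := by rw [Finset.sum_range_succ, pow_add]

end Independence

/-! ### Exponential moments of the divergence of an empirical mean -/

/-- The values that rewards take: `{0, 1}` (Bernoulli) or `ℝ` (Gaussian). -/
def RewardModel.outcomes : RewardModel → Set ℝ
  | .bernoulli => {0, 1}
  | .gaussian _ _ => Set.univ

/-- A statistic of the rewards `y s`, `s ∈ S`, of an arm with mean `p` that dominates
`exp (lam * n * D(empirical mean ‖ p))` with `n = #S`. In the Bernoulli case `lam` is fixed to be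
`1` (the argument is ignored), and the statistic is the sum, over all possible values `k / n` of the
empirical mean, of the likelihood ratios. -/
def RewardModel.tilt {TB : ℕ} (lam : ℝ) : RewardModel → ℝ → Finset (Fin TB) → (Fin TB → ℝ) → ℝ≥0∞
  | .bernoulli, p, S, y =>
    ∑ k ∈ Finset.range (S.card + 1), ∏ s ∈ S, bernoulliRatio ((k : ℝ) / S.card) p (y s)
  | .gaussian σ _, p, S, y =>
    ENNReal.ofReal (Real.exp (lam * ((∑ s ∈ S, y s - S.card * p) ^ 2 / (2 * (S.card * σ ^ 2)))))

section Tilt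

variable {TB : ℕ} (lam : ℝ) (m : RewardModel)

lemma RewardModel.measurable_tilt (p : ℝ) (S : Finset (Fin TB)) : Measurable (m.tilt lam p S) := by
  cases m with
  | bernoulli =>
    exact Finset.measurable_sum _ fun k _ => Finset.measurable_prod _ fun s _ =>
      (measurable_bernoulliRatio _ _).comp (measurable_pi_apply s)
  | gaussian σ hσ =>
    unfold RewardModel.tilt
    fun_prop

lemma RewardModel.tilt_empty (p : ℝ) (y : Fin TB → ℝ) : m.tilt lam p ∅ y = 1 := by
  cases m <;> simp [RewardModel.tilt]

end Tilt

lemma exp_mul_klFun_div {n k : ℕ} {p : ℝ} (hn : n ≠ 0) (hp : 0 < p) :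
    Real.exp (n * (p * InformationTheory.klFun ((k : ℝ) / n / p))) =
      ((k : ℝ) / n / p) ^ k * Real.exp (n * p - k) := by
  have hn' : (n : ℝ) ≠ 0 := Nat.cast_ne_zero.2 hn
  rcases Nat.eq_zero_or_pos k with rfl | hk
  · simp [InformationTheory.klFun_zero]
  · have hk' : (0 : ℝ) < k := Nat.cast_pos.2 hk
    have hx : 0 < (k : ℝ) / n / p := by positivity
    rw [← Real.exp_log (pow_pos hx k), Real.log_pow, ← Real.exp_add,
      InformationTheory.klFun_apply]
    congr 1
    field_simp
    ring

/-- The quantity `exp (n D(k / n ‖ p))` is at most (for `0 < p < 1`, equal to) the likelihood ratio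
of the Bernoulli distributions with means `k / n` and `p` at a sample with `k` ones among `n`.
Stated symmetrically in the two outcomes. -/
lemma exp_klTerm_add_klTerm_le {n k k' : ℕ} {p p' : ℝ} (hn : n ≠ 0) (hk : k + k' = n) (hp : 0 ≤ p)
    (hp' : 0 ≤ p') (hpp : p + p' = 1) :
    EReal.exp ((n * (klTerm ((k : ℝ) / n) p + klTerm ((k' : ℝ) / n) p') : ℝ≥0∞) : EReal) ≤
      (ENNReal.ofReal ((k : ℝ) / n) / ENNReal.ofReal p) ^ k *
        (ENNReal.ofReal ((k' : ℝ) / n) / ENNReal.ofReal p') ^ k' := by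
  have hn' : (0 : ℝ) < n := Nat.cast_pos.2 (Nat.pos_of_ne_zero hn)
  have key : ∀ (k k' : ℕ) (p' : ℝ), k + k' = n → p' = 1 →
      EReal.exp ((n * (klTerm ((k : ℝ) / n) 0 + klTerm ((k' : ℝ) / n) p') : ℝ≥0∞) : EReal) ≤
      (ENNReal.ofReal ((k : ℝ) / n) / ENNReal.ofReal 0) ^ k *
        (ENNReal.ofReal ((k' : ℝ) / n) / ENNReal.ofReal p') ^ k' := by
    rintro k k' _ hk rfl
    rcases Nat.eq_zero_or_pos k with rfl | hk0
    · obtain rfl : k' = n := by omega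
      simp [klTerm, hn, InformationTheory.klFun_one]
    · have h1 : ENNReal.ofReal ((k : ℝ) / n) / ENNReal.ofReal 0 = ⊤ := by
        have : 0 < (k : ℝ) / n := div_pos (Nat.cast_pos.2 hk0) hn'
        rw [ENNReal.ofReal_zero, ENNReal.div_zero]
        simpa using this
      rw [h1, ENNReal.top_pow hk0.ne', ENNReal.top_mul]
      · exact le_top
      · rcases Nat.eq_zero_or_pos k' with rfl | hk'0
        · simp
        · have : 0 < (k' : ℝ) / n := div_pos (Nat.cast_pos.2 hk'0) hn'
          simpa using fun h : (k' : ℝ) / n ≤ 0 => absurd this (not_lt.2 h)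
  -- a degenerate `p`: both sides are trivial or the right-hand side is infinite
  rcases hp.eq_or_lt with rfl | hp
  · exact key k k' p' hk (by linarith)
  rcases hp'.eq_or_lt with rfl | hp'
  · rw [add_comm (klTerm _ _), mul_comm (HPow.hPow _ k)]
    exact key k' k p (by omega) (by linarith)
  have h0 : ∀ (k : ℕ) (p : ℝ), 0 < p → 0 ≤ p * InformationTheory.klFun ((k : ℝ) / n / p) :=
    fun k p hp => mul_nonneg hp.le (InformationTheory.klFun_nonneg (by positivity))
  rw [klTerm, klTerm, if_neg hp.ne', if_neg hp'.ne', ← ENNReal.ofReal_add (h0 k p hp) (h0 k' p' hp'),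
    ← ENNReal.ofReal_natCast, ← ENNReal.ofReal_mul hn'.le,
    EReal.coe_ennreal_ofReal, max_eq_left (mul_nonneg hn'.le (add_nonneg (h0 k p hp) (h0 k' p' hp'))),
    EReal.exp_coe, ← ENNReal.ofReal_div_of_pos hp, ← ENNReal.ofReal_div_of_pos hp',
    ← ENNReal.ofReal_pow (by positivity), ← ENNReal.ofReal_pow (by positivity),
    ← ENNReal.ofReal_mul (by positivity)]
  apply ENNReal.ofReal_le_ofReal
  rw [mul_add, Real.exp_add, exp_mul_klFun_div hn hp, exp_mul_klFun_div hn hp']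
  have hkn : (k : ℝ) + k' = n := by exact_mod_cast hk
  have hE : Real.exp (n * p - k) * Real.exp (n * p' - k') = 1 := by
    rw [← Real.exp_add, Real.exp_eq_one_iff]
    linear_combination (n : ℝ) * hpp - hkn
  apply le_of_eq
  linear_combination ((k : ℝ) / n / p) ^ k * ((k' : ℝ) / n / p') ^ k' * hE

lemma exp_div_le_tilt_bernoulli {TB : ℕ} {p : ℝ} (hp : p ∈ Set.Icc (0 : ℝ) 1)
    (S : Finset (Fin TB)) {y : Fin TB → ℝ} (hy : ∀ s, y s = 0 ∨ y s = 1) (lam : ℝ) :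
    EReal.exp ((S.card * RewardModel.bernoulli.div ((∑ s ∈ S, y s) / S.card) p : ℝ≥0∞) : EReal) ≤
      RewardModel.bernoulli.tilt lam p S y := by
  rcases S.eq_empty_or_nonempty with rfl | hS
  · simp [RewardModel.tilt]
  have hn : S.card ≠ 0 := hS.card_ne_zero
  have hn' : (S.card : ℝ) ≠ 0 := Nat.cast_ne_zero.2 hn
  set k := (S.filter fun s => y s = 1).card with hk
  set k' := (S.filter fun s => ¬ y s = 1).card with hk'
  have hkk : k + k' = S.card := Finset.card_filter_add_card_filter_not _
  have hsum : ∑ s ∈ S, y s = k := by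
    rw [hk, Finset.card_filter]
    push_cast
    refine Finset.sum_congr rfl fun s _ => ?_
    rcases hy s with h | h <;> simp [h]
  have hkn : (k : ℝ) + k' = S.card := by exact_mod_cast hkk
  have h1 : 1 - (k : ℝ) / S.card = (k' : ℝ) / S.card := by
    field_simp
    linarith
  have hterm : ∏ s ∈ S, bernoulliRatio ((k : ℝ) / S.card) p (y s) =
      (ENNReal.ofReal ((k : ℝ) / S.card) / ENNReal.ofReal p) ^ k *
        (ENNReal.ofReal ((k' : ℝ) / S.card) / ENNReal.ofReal (1 - p)) ^ k' := by
    simp only [bernoulliRatio]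
    rw [Finset.prod_ite, Finset.prod_const, Finset.prod_const, h1]
  simp only [RewardModel.tilt, RewardModel.div]
  rw [hsum, h1]
  refine (exp_klTerm_add_klTerm_le hn hkk hp.1 (sub_nonneg.2 hp.2) (by ring)).trans ?_
  rw [← hterm]
  exact Finset.single_le_sum (f := fun k : ℕ => ∏ s ∈ S, bernoulliRatio ((k : ℝ) / S.card) p (y s))
    (fun _ _ => zero_le) (Finset.mem_range.2 (by omega))

lemma exp_div_le_tilt_gaussian {TB : ℕ} {σ : ℝ} (hσ : 0 < σ) {lam : ℝ} (hlam : 0 ≤ lam) (p : ℝ)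
    (S : Finset (Fin TB)) (y : Fin TB → ℝ) :
    EReal.exp ((ENNReal.ofReal lam * (S.card *
      (RewardModel.gaussian σ hσ).div ((∑ s ∈ S, y s) / S.card) p) : ℝ≥0∞) : EReal) ≤
      (RewardModel.gaussian σ hσ).tilt lam p S y := by
  rcases S.eq_empty_or_nonempty with rfl | hS
  · simp [RewardModel.tilt]
  have hn' : (0 : ℝ) < S.card := Nat.cast_pos.2 hS.card_pos
  simp only [RewardModel.tilt, RewardModel.div]
  rw [← ENNReal.ofReal_natCast, ← ENNReal.ofReal_mul hn'.le, ← ENNReal.ofReal_mul hlam,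
    EReal.coe_ennreal_ofReal, max_eq_left (by positivity), EReal.exp_coe]
  apply ENNReal.ofReal_le_ofReal
  apply le_of_eq
  congr 2
  field_simp

section Expectation

variable {Ω : Type*} [MeasurableSpace Ω] {μ : Measure Ω} {TB : ℕ}
  {Y : Fin TB → Ω → ℝ}

/-- Method of types: each likelihood ratio has expectation at most `1`, and there are `n + 1`. -/
lemma lintegral_tilt_bernoulli_le {p : ℝ} (hp : p ∈ Set.Icc (0 : ℝ) 1)
    (hY : ∀ s, Measurable (Y s)) (hlaw : ∀ s, HasLaw (Y s) (RewardModel.bernoulli.law p) μ)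
    (hind : iIndepFun Y μ) (lam : ℝ) (S : Finset (Fin TB)) :
    ∫⁻ ω, RewardModel.bernoulli.tilt lam p S (fun s => Y s ω) ∂μ ≤ TB + 1 := by
  have hone : ∀ q ∈ Set.Icc (0 : ℝ) 1, ∀ s, ∫⁻ ω, bernoulliRatio q p (Y s ω) ∂μ ≤ 1 := by
    intro q hq s
    rw [(hlaw s).lintegral_comp (measurable_bernoulliRatio q p).aemeasurable,
      lintegral_law_bernoulli hp]
    simp only [bernoulliRatio, if_true, zero_ne_one, if_false]
    refine (add_le_add ENNReal.mul_div_le ENNReal.mul_div_le).trans ?_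
    rw [← ENNReal.ofReal_add hq.1 (sub_nonneg.2 hq.2)]
    simp
  simp only [RewardModel.tilt]
  rw [lintegral_finsetSum _ fun k _ => Finset.measurable_prod _ fun s _ =>
    Measurable.fun_comp (measurable_bernoulliRatio _ _) (hY s)]
  calc _ ≤ ∑ k ∈ Finset.range (S.card + 1), (1 : ℝ≥0∞) := by
        refine Finset.sum_le_sum fun k hk => ?_
        have hq : (k : ℝ) / S.card ∈ Set.Icc (0 : ℝ) 1 :=
          ⟨by positivity, div_le_one_of_le₀
            (Nat.cast_le.2 (Nat.lt_succ_iff.1 (Finset.mem_range.1 hk))) (Nat.cast_nonneg _)⟩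
        rw [lintegral_prod_eq_prod_lintegral_of_indepFun S
          (fun s ω => bernoulliRatio ((k : ℝ) / S.card) p (Y s ω))
          (hind.comp (fun _ => bernoulliRatio ((k : ℝ) / S.card) p)
            fun _ => measurable_bernoulliRatio _ _)
          fun s => (measurable_bernoulliRatio _ _).comp (hY s)]
        exact Finset.prod_le_one' fun s _ => hone _ hq s
    _ ≤ _ := by
        simp only [Finset.sum_const, Finset.card_range, nsmul_eq_mul, mul_one]
        exact_mod_cast Nat.succ_le_succ ((Finset.card_le_univ S).trans (by simp))

lemma map_sum_gaussian [IsProbabilityMeasure μ] {p : ℝ} {v : NNReal} (hY : ∀ s, Measurable (Y s))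
    (hlaw : ∀ s, HasLaw (Y s) (gaussianReal p v) μ) (hind : iIndepFun Y μ) (S : Finset (Fin TB)) :
    μ.map (∑ s ∈ S, Y s) = gaussianReal (S.card * p) (S.card * v) := by
  induction S using Finset.cons_induction with
  | empty =>
    simp only [Finset.sum_empty, Finset.card_empty, Nat.cast_zero, zero_mul, gaussianReal_zero_var]
    have : (0 : Ω → ℝ) = fun _ => 0 := rfl
    rw [this, Measure.map_const]
    simp
  | cons j S hj ih =>
    rw [Finset.sum_cons, gaussianReal_add_gaussianReal_of_indepFun
      (iIndepFun.indepFun_finsetSum_of_notMem hind hY hj).symm (hlaw j).map_eq ih]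
    congr 1
    · rw [Finset.card_cons]; push_cast; ring
    · rw [Finset.card_cons]; push_cast; ring

/-- The Laplace transform of half of a `χ²` variable with one degree of freedom. -/
lemma lintegral_exp_sq_gaussian {lam : ℝ} (hlam1 : lam < 1) (a : ℝ) {v : NNReal} (hv : v ≠ 0) :
    ∫⁻ x, ENNReal.ofReal (Real.exp (lam * ((x - a) ^ 2 / (2 * v)))) ∂(gaussianReal a v) =
      ENNReal.ofReal ((√(1 - lam))⁻¹) := by
  have h1 : 0 < 1 - lam := sub_pos.2 hlam1
  have hv' : (0 : ℝ) < v := NNReal.coe_pos.2 (pos_iff_ne_zero.2 hv)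
  set w : NNReal := ⟨v / (1 - lam), (div_pos hv' h1).le⟩ with hw
  have hwr : (w : ℝ) = v / (1 - lam) := rfl
  have hw0 : w ≠ 0 := by
    intro h
    have : (w : ℝ) = 0 := by rw [h]; rfl
    exact (div_pos hv' h1).ne' (hwr ▸ this)
  rw [gaussianReal_of_var_ne_zero _ hv, lintegral_withDensity_eq_lintegral_mul _
    (measurable_gaussianPDF a v) (by fun_prop)]
  have : ∀ x, (gaussianPDF a v * fun x =>
      ENNReal.ofReal (Real.exp (lam * ((x - a) ^ 2 / (2 * v))))) x =
      ENNReal.ofReal ((√(1 - lam))⁻¹) * gaussianPDF a w x := by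
    intro x
    simp only [Pi.mul_apply, gaussianPDF, gaussianPDFReal]
    rw [← ENNReal.ofReal_mul (by positivity), ← ENNReal.ofReal_mul (by positivity),
      mul_assoc _ (Real.exp _), ← Real.exp_add, ← mul_assoc]
    congr 2
    · rw [hwr, ← mul_inv, ← Real.sqrt_mul h1.le]
      congr 2
      field_simp
    · rw [hwr]
      congr 1
      field_simp
      ring
  rw [lintegral_congr this, lintegral_const_mul _ (measurable_gaussianPDF a w),
    lintegral_gaussianPDF_eq_one a hw0, mul_one]

lemma lintegral_tilt_gaussian_le [IsProbabilityMeasure μ] {σ : ℝ} (hσ : 0 < σ) {p : ℝ} {lam : ℝ} (hlam : 0 ≤ lam)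
    (hlam1 : lam < 1) (hY : ∀ s, Measurable (Y s))
    (hlaw : ∀ s, HasLaw (Y s) ((RewardModel.gaussian σ hσ).law p) μ)
    (hind : iIndepFun Y μ) (S : Finset (Fin TB)) :
    ∫⁻ ω, (RewardModel.gaussian σ hσ).tilt lam p S (fun s => Y s ω) ∂μ ≤
      ENNReal.ofReal ((√(1 - lam))⁻¹) := by
  rcases S.eq_empty_or_nonempty with rfl | hS
  · simp only [RewardModel.tilt_empty, lintegral_one, measure_univ, ENNReal.one_le_ofReal]
    refine (one_le_inv₀ (Real.sqrt_pos.2 (sub_pos.2 hlam1))).2 ?_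
    exact Real.sqrt_le_one.2 (by linarith)
  set v : NNReal := ⟨σ ^ 2, sq_nonneg σ⟩ with hv
  have hvr : (v : ℝ) = σ ^ 2 := rfl
  have hv0 : v ≠ 0 := by
    intro h
    have : (v : ℝ) = 0 := by rw [h]; rfl
    exact (pow_pos hσ 2).ne' (hvr ▸ this)
  have hmap := map_sum_gaussian hY (p := p) (v := v) hlaw hind S
  have hnv : (S.card : NNReal) * v ≠ 0 := mul_ne_zero (Nat.cast_ne_zero.2 hS.card_ne_zero) hv0
  rw [← lintegral_exp_sq_gaussian hlam1 (S.card * p) hnv, ← hmap,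
    lintegral_map (by fun_prop) (by fun_prop)]
  refine le_of_eq (lintegral_congr fun ω => ?_)
  simp only [RewardModel.tilt, Finset.sum_apply, NNReal.coe_mul, NNReal.coe_natCast, hvr]

end Expectation

/-! ### Measurability of the run and the exponential Markov inequality -/

section Run

variable {K B TB : ℕ} (π : BatchRule K B) (A : Schedule K TB)

lemma batchMean_congr {x x' : ℕ → Fin K → ℝ} {β : ℕ} (S : Fin TB → Fin K) (i : Fin K)
    (h : ∀ s : Fin TB, x (β * TB + s) i = x' (β * TB + s) i) :
    batchMean x β S i = batchMean x' β S i := by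
  simp only [batchMean, h]

lemma stored_congr {x x' : ℕ → Fin K → ℝ} (a : ℕ)
    (h : ∀ t < (K + a) * TB, ∀ i, x t i = x' t i) : stored π A x a = stored π A x' a := by
  induction a with
  | zero =>
    funext _ i
    exact batchMean_congr _ _ fun s => h _ (round_lt (Nat.mul_le_mul_right _ i.isLt) s) i
  | succ a ih =>
    have hs := ih fun t ht => h t (ht.trans_le (Nat.mul_le_mul_right _ (by omega)))
    have hb : ∀ S i, batchMean x (K + a) S i = batchMean x' (K + a) S i := fun S i =>
      batchMean_congr S i fun s => h _ (round_lt le_rfl s) i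
    simp only [stored, hs, hb]

lemma draws_congr {x x' : ℕ → Fin K → ℝ} (β : ℕ)
    (h : ∀ t < β * TB, ∀ i, x t i = x' t i) : draws π A x β = draws π A x' β := by
  by_cases hβ : β < K
  · simp [draws, hβ]
  · obtain ⟨a, rfl⟩ := Nat.exists_eq_add_of_le (not_lt.1 hβ)
    rw [draws_add, draws_add, stored_congr π A a h]

lemma recommendation_congr {x x' : ℕ → Fin K → ℝ}
    (h : ∀ t < (B + K - 1) * TB, ∀ i, x t i = x' t i) :
    recommendation π A x = recommendation π A x' := by
  unfold recommendation
  congr 1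
  funext b
  have hb := b.isLt
  rw [stored_congr π A b fun t ht => h t (ht.trans_le (Nat.mul_le_mul_right _ (by omega)))]

/-- The number of arms drawn over all batches is at most `B * K`: one in each initial batch,
at most `K` in each of the `B - 1` adaptive ones. -/
lemma card_draws_le (x : ℕ → Fin K → ℝ) (β : ℕ) :
    (Finset.univ.filter fun i => ∃ s, draws π A x β s = i).card ≤ if β < K then 1 else K := by
  split_ifs with h
  · refine Finset.card_le_one.2 fun i hi j hj => ?_
    simp only [draws, h, dif_pos, Finset.mem_filter, Finset.mem_univ, true_and] at hi hj
    obtain ⟨-, rfl⟩ := hi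
    exact hj.choose_spec
  · exact (Finset.card_le_univ _).trans (by simp)

lemma sum_card_draws (hB : 0 < B) :
    ∑ β ∈ Finset.range (K + (B - 1)), (if β < K then 1 else K) = B * K := by
  rw [Finset.sum_range_add, Finset.sum_congr rfl
    (g := fun _ => 1) fun β hβ => if_pos (Finset.mem_range.1 hβ)]
  obtain ⟨n, rfl⟩ : ∃ n, B = n + 1 := ⟨B - 1, by omega⟩
  simp
  ring

section Measurability

variable {Ω : Type*}

lemma measurable_batchMean (mm : MeasurableSpace Ω) {X : ℕ → Fin K → Ω → ℝ} {β : ℕ}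
    {S : Ω → Fin TB → Fin K} (hS : Measurable S) (i : Fin K)
    (hX : ∀ s : Fin TB, Measurable (X (β * TB + s) i)) :
    Measurable fun ω => batchMean (fun t i => X t i ω) β (S ω) i := by
  have hset : ∀ s : Fin TB, MeasurableSet {ω | S ω s = i} := fun s =>
    (measurable_pi_iff.1 hS s) (measurableSet_singleton i)
  simp only [batchMean, numDraws, Finset.sum_filter, Finset.card_filter, Nat.cast_sum,
    Nat.cast_ite, Nat.cast_one, Nat.cast_zero]
  refine Measurable.div ?_ ?_
  · exact Finset.measurable_sum _ fun s _ => Measurable.ite (hset s) (hX s) measurable_const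
  · exact Finset.measurable_sum _ fun s _ =>
      Measurable.ite (hset s) measurable_const measurable_const

lemma measurable_stored (mm : MeasurableSpace Ω) {X : ℕ → Fin K → Ω → ℝ}
    (hπ : ∀ a, Measurable (π.alloc a)) (hA : ∀ a, Measurable (A a)) (a : ℕ)
    (hX : ∀ t < (K + a) * TB, ∀ i, Measurable (X t i)) :
    Measurable fun ω => stored π A (fun t i => X t i ω) a := by
  induction a with
  | zero =>
    refine measurable_pi_lambda _ fun _ => measurable_pi_lambda _ fun i => ?_
    exact measurable_batchMean mm measurable_const i fun s =>
      hX _ (round_lt (Nat.mul_le_mul_right _ i.isLt) s) i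
  | succ a ih =>
    have hs := ih fun t ht => hX t (ht.trans_le (Nat.mul_le_mul_right _ (by omega)))
    refine measurable_pi_lambda _ fun c => ?_
    induction c using Fin.lastCases with
    | cast c =>
      simp only [stored, Fin.snoc_castSucc]
      exact measurable_pi_iff.1 hs c
    | last =>
      simp only [stored, Fin.snoc_last]
      refine measurable_pi_lambda _ fun i => ?_
      have hcur : Measurable fun ω => stored π A (fun t i => X t i ω) a (Fin.last a) i :=
        measurable_pi_iff.1 (measurable_pi_iff.1 hs _) i
      refine hcur.add (Measurable.mul ?_ (Measurable.sub ?_ hcur))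
      · exact measurable_pi_iff.1 ((hπ a).comp hs) i
      · exact measurable_batchMean mm ((hA a).comp hs) i fun s => hX _ (round_lt le_rfl s) i

/-- A function of finitely many random variables with values in `{0, 1}` is measurable. -/
lemma measurable_of_zero_or_one (mm : MeasurableSpace Ω) {X : ℕ → Fin K → Ω → ℝ} {n : ℕ}
    (hX : ∀ t < n, ∀ i, Measurable (X t i)) (h01 : ∀ t i ω, X t i ω = 0 ∨ X t i ω = 1)
    {γ : Type*} [MeasurableSpace γ] (g : (ℕ → Fin K → ℝ) → γ)
    (hg : ∀ x x' : ℕ → Fin K → ℝ, (∀ t < n, ∀ i, x t i = x' t i) → g x = g x') :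
    Measurable fun ω => g (fun t i => X t i ω) := by
  let e : Ω → Fin n × Fin K → Bool := fun ω p => if X p.1 p.2 ω = 1 then true else false
  let ext : (Fin n × Fin K → Bool) → ℕ → Fin K → ℝ := fun b t i =>
    if h : t < n then (if b (⟨t, h⟩, i) = true then 1 else 0) else 0
  have he : Measurable e := measurable_pi_lambda _ fun p =>
    Measurable.ite (hX p.1 p.1.isLt p.2 (measurableSet_singleton 1))
      measurable_const measurable_const
  have heq : (fun ω => g (fun t i => X t i ω)) = fun ω => (fun b => g (ext b)) (e ω) := by
    funext ω
    refine hg _ _ fun t ht i => ?_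
    rcases h01 t i ω with h | h <;> simp [e, ext, ht, h]
  rw [heq]
  exact (measurable_of_finite fun b => g (ext b)).comp he

lemma measurable_draws (mm : MeasurableSpace Ω) {m : RewardModel} {X : ℕ → Fin K → Ω → ℝ}
    (hmeas : m ≠ RewardModel.bernoulli →
      (∀ a, Measurable (π.alloc a)) ∧ Measurable π.recommend ∧ ∀ a, Measurable (A a))
    (hout : ∀ t i ω, X t i ω ∈ m.outcomes) (β : ℕ)
    (hX : ∀ t < β * TB, ∀ i, Measurable (X t i)) :
    Measurable fun ω => draws π A (fun t i => X t i ω) β := by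
  cases m with
  | bernoulli =>
    exact measurable_of_zero_or_one mm hX hout (fun x => draws π A x β)
      fun x x' h => draws_congr π A β h
  | gaussian σ hσ =>
    obtain ⟨hπ, -, hA⟩ := hmeas (by simp)
    by_cases hβ : β < K
    · simp only [draws, hβ, dif_pos]
      exact measurable_const
    · obtain ⟨a, rfl⟩ := Nat.exists_eq_add_of_le (not_lt.1 hβ)
      simp only [draws_add]
      exact (hA a).comp (measurable_stored π A mm hπ hA a hX)

end Measurability

lemma batchMean_mem {m : RewardModel} {x : ℕ → Fin K → ℝ} (hx : ∀ t i, x t i ∈ m.outcomes)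
    (β : ℕ) (S : Fin TB → Fin K) (i : Fin K) : batchMean x β S i ∈ m.means := by
  cases m with
  | gaussian σ hσ => exact Set.mem_univ _
  | bernoulli =>
    have h0 : ∀ t i, 0 ≤ x t i := fun t i =>
      (hx t i).elim (fun h => h.ge) fun h => zero_le_one.trans h.ge
    have h1 : ∀ t i, x t i ≤ 1 := fun t i =>
      (hx t i).elim (fun h => h.le.trans zero_le_one) fun h => h.le
    refine ⟨div_nonneg (Finset.sum_nonneg fun s _ => h0 _ i) (Nat.cast_nonneg _), ?_⟩
    refine div_le_one_of_le₀ ?_ (Nat.cast_nonneg _)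
    refine (Finset.sum_le_card_nsmul _ _ 1 fun s _ => h1 _ i).trans ?_
    simp [numDraws]

end Run

section Modification

variable {Ω : Type*} [MeasurableSpace Ω] {μ : Measure Ω}

/-- A measurable version of a reward, all of whose values are possible outcomes. -/
lemma exists_measurable_outcome {m : RewardModel} {p : ℝ} {Y : Ω → ℝ}
    (hp : p ∈ m.means) (hY : HasLaw Y (m.law p) μ) :
    ∃ Z : Ω → ℝ, Measurable Z ∧ (∀ ω, Z ω ∈ m.outcomes) ∧ Y =ᵐ[μ] Z := by
  cases m with
  | gaussian σ hσ =>
    exact ⟨hY.aemeasurable.mk Y, hY.aemeasurable.measurable_mk, fun _ => Set.mem_univ _,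
      hY.aemeasurable.ae_eq_mk⟩
  | bernoulli =>
    have hset : MeasurableSet {y : ℝ | y = 0 ∨ y = 1} :=
      (measurableSet_singleton 0).union (measurableSet_singleton 1)
    have h01 : ∀ᵐ ω ∂μ, Y ω = 0 ∨ Y ω = 1 := by
      rw [hY.ae_iff (p := fun y => y = 0 ∨ y = 1) (measurableSet_setOfPred.1 hset), ae_iff]
      have hs : MeasurableSet {y : ℝ | ¬(y = 0 ∨ y = 1)} := hset.compl
      rw [← lintegral_indicator_one hs, lintegral_law_bernoulli hp]
      simp
    refine ⟨fun ω => if hY.aemeasurable.mk Y ω = 1 then 1 else 0, ?_, fun ω => ?_, ?_⟩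
    · exact Measurable.ite (hY.aemeasurable.measurable_mk (measurableSet_singleton 1))
        measurable_const measurable_const
    · dsimp only
      split_ifs
      · exact Or.inr rfl
      · exact Or.inl rfl
    · filter_upwards [h01, hY.aemeasurable.ae_eq_mk] with ω h1 h2
      rw [← h2]
      rcases h1 with h | h <;> simp [h]

end Modification

lemma exp_coe_sum {ι : Type*} (s : Finset ι) (f : ι → ℝ≥0∞) :
    EReal.exp ((∑ i ∈ s, f i : ℝ≥0∞) : EReal) = ∏ i ∈ s, EReal.exp (f i : EReal) := by
  induction s using Finset.cons_induction with
  | empty => simp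
  | cons j s hj ih =>
    rw [Finset.sum_cons, Finset.prod_cons, EReal.coe_ennreal_add, EReal.exp_add, ih]

section Tail

variable {K B TB : ℕ}

/-- Exponential Markov inequality for the statistic `∑ n_{β,i} D(Q_{β,i} ‖ P_i)`: if a wrong
recommendation forces it to be at least `C`, the error probability is at most
`exp (- lam C) * c ^ (B K)`, where `c` bounds the exponential moment of one arm in one batch. -/
lemma measure_recommendation_notMem_le (hB : 0 < B) {m : RewardModel} {π : BatchRule K B}
    {A : Schedule K TB}
    (hmeas : m ≠ RewardModel.bernoulli →
      (∀ a, Measurable (π.alloc a)) ∧ Measurable π.recommend ∧ ∀ a, Measurable (A a))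
    {P : Fin K → ℝ} (hP : ∀ i, P i ∈ m.means) {Ω : Type*} [MeasurableSpace Ω] {μ : Measure Ω}
    [IsProbabilityMeasure μ] {X : ℕ → Fin K → Ω → ℝ} {T : ℕ} (hT : T = (B + K - 1) * TB)
    (hlaw : ∀ t < T, ∀ i, HasLaw (X t i) (m.law (P i)) μ)
    (hindep : iIndepFun (fun (p : Fin T × Fin K) => X p.1 p.2) μ)
    {lam : ℝ} (hlam : 0 ≤ lam) {c : ℝ≥0∞} (hc : 1 ≤ c)
    (hexp : ∀ i (S : Finset (Fin TB)) (y : Fin TB → ℝ), (∀ s, y s ∈ m.outcomes) →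
      EReal.exp ((ENNReal.ofReal lam *
        (S.card * m.div ((∑ s ∈ S, y s) / S.card) (P i)) : ℝ≥0∞) : EReal) ≤ m.tilt lam (P i) S y)
    (hint : ∀ i (S : Finset (Fin TB)) (Y : Fin TB → Ω → ℝ), (∀ s, Measurable (Y s)) →
      (∀ s, HasLaw (Y s) (m.law (P i)) μ) → iIndepFun Y μ →
      ∫⁻ ω, m.tilt lam (P i) S (fun s => Y s ω) ∂μ ≤ c)
    {C : ℝ}
    (hC : ∀ x : ℕ → Fin K → ℝ, (∀ β (S : Fin TB → Fin K) i, batchMean x β S i ∈ m.means) →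
      recommendation π A x ∉ bestArms P →
      ENNReal.ofReal C ≤ ∑ β ∈ Finset.range (K + (B - 1)), ∑ i : Fin K,
        (numDraws (draws π A x β) i : ℝ≥0∞) *
          m.div (batchMean x β (draws π A x β) i) (P i)) :
    μ {ω | recommendation π A (fun t i => X t i ω) ∉ bestArms P} ≤
      ENNReal.ofReal (Real.exp (-(lam * C))) * c ^ (B * K) := by
  have hout0 : (0 : ℝ) ∈ m.outcomes := by
    cases m
    · exact Or.inl rfl
    · exact Set.mem_univ _
  choose Z hZm hZo hZe using fun (t : ℕ) (ht : t < T) (i : Fin K) =>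
    exists_measurable_outcome (hP i) (hlaw t ht i)
  set X' : ℕ → Fin K → Ω → ℝ := fun t i => if ht : t < T then Z t ht i else fun _ => 0 with hX'
  have hX'm : ∀ t i, Measurable (X' t i) := fun t i => by
    by_cases ht : t < T
    · simpa [hX', ht] using hZm t ht i
    · simp [hX', ht]
  have hX'o : ∀ t i ω, X' t i ω ∈ m.outcomes := fun t i ω => by
    by_cases ht : t < T
    · simpa [hX', ht] using hZo t ht i ω
    · simpa [hX', ht] using hout0
  have hX'e : ∀ t < T, ∀ i, X t i =ᵐ[μ] X' t i := fun t ht i => by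
    simpa [hX', ht] using hZe t ht i
  have hX'l : ∀ t < T, ∀ i, HasLaw (X' t i) (m.law (P i)) μ := fun t ht i =>
    (hlaw t ht i).congr (hX'e t ht i).symm
  have hX'i : iIndepFun (fun (p : Fin T × Fin K) => X' p.1 p.2) μ :=
    (iIndepFun_congr fun p : Fin T × Fin K => hX'e p.1 p.1.isLt p.2).1 hindep
  have hNT : K + (B - 1) = B + K - 1 := by omega
  have hae : ∀ᵐ ω ∂μ, ∀ t < T, ∀ i, X t i ω = X' t i ω := by
    rw [ae_all_iff]
    intro t
    by_cases ht : t < T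
    · filter_upwards [ae_all_iff.2 (hX'e t ht)] with ω hω _ i using hω i
    · exact Filter.Eventually.of_forall fun ω h => absurd h ht
  set S : ℕ → Ω → Fin TB → Fin K := fun β ω => draws π A (fun t i => X' t i ω) β with hS
  set Φ : Fin K → Finset (Fin TB) → (Fin TB → ℝ) → ℝ≥0∞ := fun i s y => m.tilt lam (P i) s y
    with hΦ
  have hΦm : ∀ i s, Measurable (Φ i s) := fun i s => m.measurable_tilt lam (P i) s
  have hle : (K + (B - 1)) * TB ≤ T := by rw [hT, hNT]
  have hSm : ∀ β < K + (B - 1), Measurable[past X' T (β * TB)] (S β) := by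
    intro β hβ
    refine measurable_draws π A _ hmeas hX'o β fun t ht i => measurable_past ht ?_ i
    exact (ht.trans_le (Nat.mul_le_mul_right _ hβ.le)).trans_le hle
  set F : Ω → ℝ≥0∞ := fun ω => ∏ β ∈ Finset.range (K + (B - 1)), batchProd X' Φ β (S β ω) ω
    with hF
  have hFm : Measurable F := (measurable_prod_batchProd hΦm hle hSm).mono
    (past_le (fun t _ i => hX'm t i) _) le_rfl
  have hFint : ∫⁻ ω, F ω ∂μ ≤ c ^ (B * K) := by
    rw [← sum_card_draws hB]
    refine lintegral_prod_batchProd_le (fun t _ i => hX'm t i) hX'i hΦm hc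
      (fun i y => m.tilt_empty lam (P i) y) ?_ (fun β ω => card_draws_le π A _ β) _ hle hSm
    intro β hβ i s
    refine hint i s (fun r => X' (β * TB + r) i) (fun r => hX'm _ i)
      (fun r => hX'l _ (round_lt hβ r) i) ?_
    refine hX'i.precomp (g := fun r : Fin TB => (⟨β * TB + r, round_lt hβ r⟩, i)) ?_
    intro r r' h
    simpa [Fin.ext_iff] using h
  have hsub : ∀ᵐ ω ∂μ, recommendation π A (fun t i => X t i ω) ∉ bestArms P →
      ENNReal.ofReal (Real.exp (lam * C)) ≤ F ω := by
    filter_upwards [hae] with ω hω hrec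
    rw [recommendation_congr π A (x' := fun t i => X' t i ω) (hT ▸ hω)] at hrec
    have h := hC _ (batchMean_mem fun t i => hX'o t i ω) hrec
    have h2 : EReal.exp ((ENNReal.ofReal lam * ∑ β ∈ Finset.range (K + (B - 1)), ∑ i : Fin K,
        (numDraws (S β ω) i : ℝ≥0∞) *
          m.div (batchMean (fun t i => X' t i ω) β (S β ω) i) (P i) : ℝ≥0∞) : EReal) ≤ F ω := by
      simp only [Finset.mul_sum, exp_coe_sum]
      exact Finset.prod_le_prod' fun β _ => Finset.prod_le_prod' fun i _ =>
        hexp i _ (fun s => X' (β * TB + s) i ω) fun s => hX'o _ i ω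
    refine le_trans ?_ h2
    rw [← EReal.exp_coe]
    refine EReal.exp_monotone (le_trans ?_ (EReal.coe_ennreal_le_coe_ennreal_iff.2
      (mul_le_mul_right h (ENNReal.ofReal lam))))
    rw [← ENNReal.ofReal_mul hlam, EReal.coe_ennreal_ofReal]
    exact EReal.coe_le_coe_iff.2 (le_max_left _ _)
  have hε : ENNReal.ofReal (Real.exp (lam * C)) ≠ 0 := by simpa using Real.exp_pos _
  calc μ {ω | recommendation π A (fun t i => X t i ω) ∉ bestArms P}
      ≤ μ {ω | ENNReal.ofReal (Real.exp (lam * C)) ≤ F ω} := measure_mono_ae hsub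
    _ ≤ (∫⁻ ω, F ω ∂μ) / ENNReal.ofReal (Real.exp (lam * C)) :=
        meas_ge_le_lintegral_div hFm.aemeasurable hε ENNReal.ofReal_ne_top
    _ ≤ c ^ (B * K) / ENNReal.ofReal (Real.exp (lam * C)) := by gcongr
    _ = _ := by
        rw [div_eq_mul_inv, ← ENNReal.ofReal_inv_of_pos (Real.exp_pos _), ← Real.exp_neg, mul_comm]

end Tail

/-! ### The rate and the choice of the Chernoff parameter -/

section Rate

variable {K B TB : ℕ}

/-- A wrong recommendation forces the statistic of the draws to be at least `B (TB - K) r`, for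
every `r ≤ (R^go_B - ε) / H(P)`. -/
lemma ofReal_le_statistic (hB : 0 < B) {m : RewardModel} {Θ : Set ℝ} (hΘ : Θ ⊆ m.means)
    {H : (Fin K → ℝ) → ℝ≥0∞} {ε : ℝ} {π : BatchRule K B} (hπ : IsEpsOptimal m Θ H ε π)
    (hTB : K ≤ TB) {A : Schedule K TB} (hA : A.Follows π) {P : Fin K → ℝ} (hP : ∀ i, P i ∈ Θ)
    (hH0 : 0 < H P) (hHtop : H P ≠ ⊤) {r : ℝ} (hr0 : 0 ≤ r)
    (hr : (r : EReal) ≤ ((Rgo B m Θ H : EReal) - (ε : EReal)) / (H P : EReal))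
    {x : ℕ → Fin K → ℝ} (hx : ∀ β (S : Fin TB → Fin K) i, batchMean x β S i ∈ m.means)
    (hrec : recommendation π A x ∉ bestArms P) :
    ENNReal.ofReal (B * ((TB : ℝ) - K) * r) ≤ ∑ β ∈ Finset.range (K + (B - 1)), ∑ i : Fin K,
        (numDraws (draws π A x β) i : ℝ≥0∞) *
          m.div (batchMean x β (draws π A x β) i) (P i) := by
  have hobj := objective_le_of_recommendation_notMem π A x hB m hΘ H hP
    (fun β _ S i => hx β S i) hrec
  refine le_trans ?_ (weighted_div_current_le π A x hB m (fun i => hΘ (hP i)) hA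
    fun β _ S i => hx β S i)
  set D := ∑ b ∈ Finset.range B, ∑ i : Fin K,
        ENNReal.ofReal (π.alloc b (stored π A x b) i) * m.div (current π A x b i) (P i)
  have hB' : (B : ℝ≥0∞) ≠ 0 := Nat.cast_ne_zero.2 hB.ne'
  have hrS : ENNReal.ofReal r ≤ D / B := by
    have h1 : ((Rgo B m Θ H : EReal) - (ε : EReal)) / (H P : EReal) ≤ ((D / B : ℝ≥0∞) : EReal) := by
      rw [EReal.div_le_iff_le_mul (by simpa using hH0)
        (by simpa using hHtop), ← EReal.coe_ennreal_mul]
      refine hπ.trans (EReal.coe_ennreal_le_coe_ennreal_iff.2 (hobj.trans (le_of_eq ?_)))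
      simp only [div_eq_mul_inv]
      ring
    rw [← EReal.coe_ennreal_le_coe_ennreal_iff, EReal.coe_ennreal_ofReal, max_eq_left hr0]
    exact hr.trans h1
  have hd : (0 : ℝ) ≤ (TB : ℝ) - K := sub_nonneg.2 (Nat.cast_le.2 hTB)
  calc ENNReal.ofReal (B * ((TB : ℝ) - K) * r)
      = ENNReal.ofReal ((TB : ℝ) - K) * (B * ENNReal.ofReal r) := by
        rw [mul_comm (B : ℝ), mul_assoc, ENNReal.ofReal_mul hd,
          ENNReal.ofReal_mul (Nat.cast_nonneg B), ENNReal.ofReal_natCast]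
    _ ≤ ENNReal.ofReal ((TB : ℝ) - K) * (B * (D / B)) := by gcongr
    _ = _ := by rw [ENNReal.mul_div_cancel hB' (ENNReal.natCast_ne_top B)]

end Rate

section Numerics

lemma one_le_exp_neg_add {z : EReal} {E : ℝ} (hz : z ≤ 0) (hE : 0 ≤ E) :
    1 ≤ EReal.exp (-z + (E : EReal)) := by
  rw [EReal.one_le_exp_iff]
  exact add_nonneg (EReal.neg_nonneg.2 hz) (EReal.coe_nonneg.2 hE)

lemma exp_two_mul_log (N : ℕ) {T : ℝ} (hT : 0 < T) :
    Real.exp (2 * N * Real.log (2 * T)) = ((2 * T) ^ 2) ^ N := by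
  rw [← pow_mul, ← Real.exp_log (pow_pos (mul_pos two_pos hT) (2 * N)), Real.log_pow]
  push_cast
  rfl

/-- The Chernoff bound at the optimal parameter `lam = 1 - N / (2 C)`. -/
lemma exp_mul_inv_sqrt_pow_le {N : ℕ} (hN : 0 < N) {C T : ℝ} (hT : 1 ≤ T) (hNC : (N : ℝ) / 2 < C)
    (hCT : C ≤ N * T ^ 4) :
    Real.exp (-((1 - N / (2 * C)) * C)) * (√(1 - (1 - N / (2 * C))))⁻¹ ^ N ≤
      Real.exp (-C) * ((2 * T) ^ 2) ^ N := by
  have hN' : (0 : ℝ) < N := Nat.cast_pos.2 hN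
  have hC : 0 < C := (by positivity : (0 : ℝ) < N / 2).trans hNC
  have e1 : -((1 - N / (2 * C)) * C) = -C + N * (1 / 2) := by
    field_simp
    ring
  rw [e1, Real.exp_add, Real.exp_nat_mul, mul_assoc, ← mul_pow]
  gcongr
  have h1 : Real.exp (1 / 2) ≤ 2 := by
    have : Real.exp (1 / 2) ^ 2 ≤ 2 ^ 2 := by
      rw [← Real.exp_nat_mul]
      norm_num
      linarith [Real.exp_one_lt_d9]
    exact (pow_le_pow_iff_left₀ (Real.exp_pos _).le two_pos.le two_ne_zero).1 this
  have h2 : (√(1 - (1 - N / (2 * C))))⁻¹ ≤ 2 * T ^ 2 := by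
    rw [← Real.sqrt_inv, Real.sqrt_le_left (by positivity)]
    have : (1 - (1 - (N : ℝ) / (2 * C)))⁻¹ = 2 * C / N := by
      rw [sub_sub_cancel, inv_div]
    rw [this, div_le_iff₀ hN']
    nlinarith [mul_pos hN' (pow_pos (zero_lt_one.trans_le hT) 4)]
  calc _ ≤ 2 * (2 * T ^ 2) := by gcongr
    _ = _ := by ring

end Numerics

end DOT

end

/-! ### The error probability -/

theorem mainTheorem4
    {K B : ℕ} (hB : 0 < B)
    -- the reward family, the known set of possible means, and the complexity measure
    (m : DOT.RewardModel) (Θ : Set ℝ) (hΘ : Θ ⊆ m.means)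
    (H : (Fin K → ℝ) → ℝ≥0∞) (hH : ∀ P : Fin K → ℝ, (∀ i, P i ∈ Θ) → 0 < H P)
    -- an `ε`-optimal solution of the batch problem
    (ε : ℝ) (hε : 0 ≤ ε) (π : DOT.BatchRule K B) (hπ : DOT.IsEpsOptimal m Θ H ε π)
    -- the number of rounds is `B + K - 1` times the batch size, and `T' ≥ 0`
    (T TB : ℕ) (hT : T = (B + K - 1) * TB) (hTB : K ≤ TB)
    -- the draws in the adaptive batches
    (A : DOT.Schedule K TB) (hA : A.Follows π)
    -- measurability of the algorithm (automatic for rewards with finitely many values)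
    (hmeas : m ≠ DOT.RewardModel.bernoulli →
      (∀ a, Measurable (π.alloc a)) ∧ Measurable π.recommend ∧ ∀ a, Measurable (A a))
    -- the instance, and independent rewards `X t i` of arm `i` at round `t < T`
    (P : Fin K → ℝ) (hP : ∀ i, P i ∈ Θ)
    {Ω : Type*} [MeasurableSpace Ω] (μ : Measure Ω) [IsProbabilityMeasure μ]
    (X : ℕ → Fin K → Ω → ℝ)
    (hlaw : ∀ t < T, ∀ i, HasLaw (X t i) (m.law (P i)) μ)
    (hindep : iIndepFun (fun (p : Fin T × Fin K) => X p.1 p.2) μ)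
    -- for Gaussian arms, `T` is large compared to the instance
    (hlarge : m ≠ DOT.RewardModel.bernoulli → DOT.Rgo B m Θ H ≠ ⊤ →
      ((DOT.Rgo B m Θ H : EReal) - (ε : EReal)) / (H P : EReal) ≤ (((T : ℝ) ^ 3 : ℝ) : EReal)) :
    μ {ω | DOT.recommendation π A (fun t i => X t i ω) ∉ DOT.bestArms P} ≤
      EReal.exp
        (-((((B : ℝ) * ((T : ℝ) - ((B : ℝ) + K - 1) * K) / ((B : ℝ) + K - 1) : ℝ) : EReal) *
            (((DOT.Rgo B m Θ H : EReal) - (ε : EReal)) / (H P : EReal))) +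
          ((2 * B * K * Real.log (2 * T) : ℝ) : EReal)) := by
  have hK : 0 < K := (π.recommend fun _ _ => 0).pos
  have hTB1 : 1 ≤ TB := hK.trans_le hTB
  have hTBT : TB ≤ T := by
    rw [hT]
    exact Nat.le_mul_of_pos_left TB (by omega)
  have hT1 : (1 : ℝ) ≤ T := by exact_mod_cast hTB1.trans hTBT
  have hd : (0 : ℝ) ≤ (TB : ℝ) - K := sub_nonneg.2 (Nat.cast_le.2 hTB)
  have hB' : (0 : ℝ) < B := Nat.cast_pos.2 hB
  have hcoef : (B : ℝ) * ((T : ℝ) - ((B : ℝ) + K - 1) * K) / ((B : ℝ) + K - 1) =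
      B * ((TB : ℝ) - K) := by
    have hTr : (T : ℝ) = ((B : ℝ) + K - 1) * TB := by
      rw [hT, Nat.cast_mul, Nat.cast_sub (by omega), Nat.cast_add, Nat.cast_one]
    have hne : (B : ℝ) + K - 1 ≠ 0 := by
      have h1 : (1 : ℝ) ≤ B := by exact_mod_cast hB
      have h2 : (1 : ℝ) ≤ K := by exact_mod_cast hK
      linarith
    rw [hTr]
    field_simp
  rw [hcoef]
  set q : EReal := ((DOT.Rgo B m Θ H : EReal) - (ε : EReal)) / (H P : EReal) with hq
  set E : ℝ := 2 * B * K * Real.log (2 * T) with hE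
  have hE0 : 0 ≤ E := mul_nonneg (by positivity) (Real.log_nonneg (by linarith))
  have hEexp : Real.exp E = ((2 * T : ℝ) ^ 2) ^ (B * K) := by
    rw [← DOT.exp_two_mul_log (B * K) (zero_lt_one.trans_le hT1), hE]
    push_cast
    ring_nf
  have htriv : ((B * ((TB : ℝ) - K) : ℝ) : EReal) * q ≤ 0 →
      μ {ω | DOT.recommendation π A (fun t i => X t i ω) ∉ DOT.bestArms P} ≤
        EReal.exp (-(((B * ((TB : ℝ) - K) : ℝ) : EReal) * q) + (E : EReal)) := fun h =>
    prob_le_one.trans (DOT.one_le_exp_neg_add h hE0)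
  -- the cases in which the bound is at least `1`
  by_cases hHtop : H P = ⊤
  · refine htriv (le_of_eq ?_)
    rw [hq, hHtop, EReal.coe_ennreal_top, EReal.div_top, mul_zero]
  rcases le_or_gt q 0 with hq0 | hq0
  · refine htriv ?_
    have := mul_le_mul_of_nonneg_left hq0 (EReal.coe_nonneg.2 (mul_nonneg hB'.le hd))
    rwa [mul_zero] at this
  rcases hd.eq_or_lt with hd0 | hd0
  · refine htriv (le_of_eq ?_)
    rw [← hd0, mul_zero, EReal.coe_zero, zero_mul]
  have hBd : 0 < B * ((TB : ℝ) - K) := mul_pos hB' hd0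
  have hPm : ∀ i, P i ∈ m.means := fun i => hΘ (hP i)
  have hstat := fun (r : ℝ) (hr0 : 0 ≤ r) (hr : (r : EReal) ≤ q) (x : ℕ → Fin K → ℝ) =>
    DOT.ofReal_le_statistic (x := x) hB hΘ hπ hTB hA hP (hH P hP) hHtop hr0 hr
  have hbern : m = DOT.RewardModel.bernoulli → ∀ r : ℝ, 0 ≤ r → (r : EReal) ≤ q →
      μ {ω | DOT.recommendation π A (fun t i => X t i ω) ∉ DOT.bestArms P} ≤
        ENNReal.ofReal (Real.exp (-(1 * (B * ((TB : ℝ) - K) * r)))) *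
          ((TB : ℝ≥0∞) + 1) ^ (B * K) := by
    rintro rfl r hr0 hr
    refine DOT.measure_recommendation_notMem_le hB hmeas hPm hT hlaw hindep zero_le_one
      (by simp) (fun i S y hy => ?_)
      (fun i S Y hYm hYl hYi => DOT.lintegral_tilt_bernoulli_le (hPm i) hYm hYl hYi 1 S)
      (fun x hx hrec => hstat r hr0 hr x hx hrec)
    rw [ENNReal.ofReal_one, one_mul]
    exact DOT.exp_div_le_tilt_bernoulli (hPm i) S hy 1
  have hgauss : m ≠ DOT.RewardModel.bernoulli → ∀ lam : ℝ, 0 ≤ lam → lam < 1 →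
      ∀ r : ℝ, 0 ≤ r → (r : EReal) ≤ q →
      μ {ω | DOT.recommendation π A (fun t i => X t i ω) ∉ DOT.bestArms P} ≤
        ENNReal.ofReal (Real.exp (-(lam * (B * ((TB : ℝ) - K) * r)))) *
          ENNReal.ofReal ((√(1 - lam))⁻¹) ^ (B * K) := by
    intro hm lam hlam hlam1 r hr0 hr
    cases m with
    | bernoulli => exact absurd rfl hm
    | gaussian σ hσ =>
      refine DOT.measure_recommendation_notMem_le hB hmeas hPm hT hlaw hindep hlam ?_
        (fun i S y _ => DOT.exp_div_le_tilt_gaussian hσ hlam (P i) S y)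
        (fun i S Y hYm hYl hYi => DOT.lintegral_tilt_gaussian_le hσ hlam hlam1 hYm hYl hYi S)
        (fun x hx hrec => hstat r hr0 hr x hx hrec)
      rw [ENNReal.one_le_ofReal]
      exact (one_le_inv₀ (Real.sqrt_pos.2 (sub_pos.2 hlam1))).2
        (Real.sqrt_le_one.2 (by linarith))
  by_cases hqtop : q = ⊤
  · -- an infinite rate: let `r → ∞` in the tail bound
    have hlim : ∃ lam : ℝ, 0 < lam ∧ ∃ c : ℝ≥0∞, c ≠ ⊤ ∧ ∀ n : ℕ,
        μ {ω | DOT.recommendation π A (fun t i => X t i ω) ∉ DOT.bestArms P} ≤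
          ENNReal.ofReal (Real.exp (-(lam * (B * ((TB : ℝ) - K) * n)))) * c := by
      by_cases hm : m = DOT.RewardModel.bernoulli
      · exact ⟨1, one_pos, _, ENNReal.pow_ne_top (by simp), fun n =>
          hbern hm n (Nat.cast_nonneg n) (hqtop ▸ le_top)⟩
      · exact ⟨1 / 2, by norm_num, _, ENNReal.pow_ne_top ENNReal.ofReal_ne_top, fun n =>
          hgauss hm (1 / 2) (by norm_num) (by norm_num) n (Nat.cast_nonneg n) (hqtop ▸ le_top)⟩
    obtain ⟨lam, hlam, c, hc, hle⟩ := hlim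
    have h1 : Filter.Tendsto (fun n : ℕ => Real.exp (-(lam * (B * ((TB : ℝ) - K) * n))))
        Filter.atTop (nhds 0) := by
      refine Real.tendsto_exp_neg_atTop_nhds_zero.comp ?_
      exact (tendsto_natCast_atTop_atTop.const_mul_atTop hBd).const_mul_atTop hlam
    have h2 := ENNReal.Tendsto.mul_const (b := c) (ENNReal.tendsto_ofReal h1) (Or.inr hc)
    rw [ENNReal.ofReal_zero, zero_mul] at h2
    exact (ge_of_tendsto' h2 hle).trans zero_le
  -- a finite positive rate `r`
  lift q to ℝ using ⟨hqtop, (EReal.bot_lt_zero.trans hq0).ne'⟩ with r hr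
  have hr0 : 0 < r := by exact_mod_cast hq0
  set C : ℝ := B * ((TB : ℝ) - K) * r with hC
  have hrhs : EReal.exp (-(((B * ((TB : ℝ) - K) : ℝ) : EReal) * (r : EReal)) + (E : EReal)) =
      ENNReal.ofReal (Real.exp (-C) * ((2 * T : ℝ) ^ 2) ^ (B * K)) := by
    rw [← EReal.coe_mul, ← EReal.coe_neg, ← EReal.coe_add, EReal.exp_coe, Real.exp_add, hEexp]
  rw [hrhs]
  by_cases hm : m = DOT.RewardModel.bernoulli
  · refine (hbern hm r hr0.le le_rfl).trans ?_
    have hcast : (TB : ℝ≥0∞) + 1 = ENNReal.ofReal ((TB : ℝ) + 1) := by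
      rw [ENNReal.ofReal_add (Nat.cast_nonneg _) zero_le_one, ENNReal.ofReal_natCast,
        ENNReal.ofReal_one]
    rw [hcast, ← ENNReal.ofReal_pow (by positivity), ← ENNReal.ofReal_mul (Real.exp_pos _).le,
      one_mul]
    have hTBT' : (TB : ℝ) ≤ T := Nat.cast_le.2 hTBT
    gcongr
    nlinarith
  · have hRtop : DOT.Rgo B m Θ H ≠ ⊤ := by
      intro h
      apply EReal.coe_ne_top r
      rw [hq, h, EReal.coe_ennreal_top, EReal.top_sub_coe]
      exact EReal.top_div_of_pos_ne_top (by simpa using hH P hP) (by simpa using hHtop)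
    have hrT : r ≤ (T : ℝ) ^ 3 := by exact_mod_cast hlarge hm hRtop
    have hN : 0 < B * K := Nat.mul_pos hB hK
    by_cases hNC : ((B * K : ℕ) : ℝ) / 2 < C
    · have hCT : C ≤ ((B * K : ℕ) : ℝ) * (T : ℝ) ^ 4 := by
        have hTBT' : (TB : ℝ) ≤ T := Nat.cast_le.2 hTBT
        have hK1 : (1 : ℝ) ≤ K := by exact_mod_cast hK
        calc C ≤ B * T * (T : ℝ) ^ 3 := by
              rw [hC]
              gcongr
              linarith
          _ = B * 1 * (T : ℝ) ^ 4 := by ring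
          _ ≤ B * K * (T : ℝ) ^ 4 := by gcongr
          _ = _ := by push_cast; rfl
      have hC0 : 0 < C := mul_pos hBd hr0
      have hx1 : ((B * K : ℕ) : ℝ) / (2 * C) < 1 := by
        rw [div_lt_one (by positivity)]
        linarith
      have hx0 : 0 < ((B * K : ℕ) : ℝ) / (2 * C) := div_pos (Nat.cast_pos.2 hN) (by positivity)
      refine (hgauss hm (1 - ((B * K : ℕ) : ℝ) / (2 * C)) (by linarith) (by linarith) r hr0.le
        le_rfl).trans ?_
      rw [← ENNReal.ofReal_pow (by positivity), ← ENNReal.ofReal_mul (Real.exp_pos _).le]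
      exact ENNReal.ofReal_le_ofReal (DOT.exp_mul_inv_sqrt_pow_le hN hT1 hNC hCT)
    · -- for small `C` the bound exceeds `1`
      refine prob_le_one.trans ?_
      rw [ENNReal.one_le_ofReal, ← hEexp, ← Real.exp_add, Real.one_le_exp_iff]
      have hlog : Real.log 2 ≤ Real.log (2 * T) :=
        Real.log_le_log two_pos (by linarith)
      have hlog2 := Real.log_two_gt_d9
      have hBK : (0 : ℝ) < B * K := by exact_mod_cast hN
      have : (B * K : ℝ) * (1 / 2) ≤ B * K * (2 * Real.log (2 * T)) := by
        gcongr
        linarith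
      push_cast at hNC
      rw [hE]
      linarith
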